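/- Let $(R_0,\mathfrak m_0)$ be an Artinian local ring with infinite residue field, let $R=R_0[x_1,\dots,x_n]$ be the polynomial ring in $n$ indeterminates with its standard grading, $R_+=\bigoplus_{t>0}R_t$, and let $I\subseteq R_+$ be a homogeneous ideal with $\dim R/I=d\ge 1$. Put $c=n-d$. For $0\le i\le d$ let $a_i(R/I)=\sup\{t\in\mathbb Z : H^i_{R_+}(R/I)_t\ne 0\}$ (with $\sup\emptyset=-\infty$), and let $\operatorname{reg}(R/I)=\max\{a_i(R/I)+i : 0\le i\le d\}$ be the Castelnuovo–Mumford regularity. Let the Hilbert coefficients $e_0(R/I),\dots,e_{d-1}(R/I)$ be the integers with $$\ell_{R_0}\big((R/I)_t\big)=\sum_{i=0}^{d-1}(-1)^i e_i(R/I)\binom{t+d-1-i}{d-1-i}\qquad\text{for all } t\gg 0,$$ where $\ell$ denotes length. Then these coefficients exist, and: (a) if $c\ge 1$, then $\displaystyle \operatorname{reg}(R/I)\ \ge\ \Big(\frac{c!\,e_0(R/I)}{\ell(R_0)}\Big)^{1/c}-\frac{c+1}{2}$; (b) for all $1\le i\le d-1$, $\displaystyle \operatorname{reg}(R/I)\ \ge\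 \Big(\frac{|e_i(R/I)|}{\ell(R_0)}\Big)^{1/(c+i)}-1$. -/

import Mathlib

noncomputable section

namespace CMReg

open MvPolynomial Filter

variable {n : ℕ} {R₀ : Type*} [CommRing R₀]

/-- The multiplicative set of all monomials in the variables `x_j`, `j ∈ S`. Inverting it is
the same as inverting the product `∏_{j ∈ S} x_j`. -/
def coordSubmonoid (R₀ : Type*) [CommRing R₀] (S : Finset (Fin n)) :
    Submonoid (MvPolynomial (Fin n) R₀) :=
  Submonoid.closure ((fun j => (X j : MvPolynomial (Fin n) R₀)) '' (S : Set (Fin n)))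

theorem coordSubmonoid_mono {S T : Finset (Fin n)} (h : S ⊆ T) :
    coordSubmonoid R₀ S ≤ coordSubmonoid R₀ T :=
  Submonoid.closure_mono (Set.image_mono (by exact_mod_cast h))

section Module

variable (n : ℕ) (R₀ : Type*) [CommRing R₀]
variable (M : Type*) [AddCommGroup M] [Module (MvPolynomial (Fin n) R₀) M]

/-- The localization `M_{x_S}`, where `x_S = ∏_{j ∈ S} x_j`. -/
abbrev CoordLoc (S : Finset (Fin n)) : Type _ :=
  LocalizedModule (coordSubmonoid R₀ S) M

/-- The canonical map `M_{x_S} → M_{x_T}` for `S ⊆ T`. -/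
def coordLocMap {S T : Finset (Fin n)} (h : S ⊆ T) :
    CoordLoc n R₀ M S →ₗ[MvPolynomial (Fin n) R₀] CoordLoc n R₀ M T :=
  LocalizedModule.liftOfLE (coordSubmonoid R₀ S) (coordSubmonoid R₀ T) (coordSubmonoid_mono h)

/-- The `i`-th term `⊕_{|S| = i} M_{x_S}` of the Čech complex of `M` with respect to
`x_1, …, x_n`. -/
abbrev CechCochain (i : ℕ) : Type _ :=
  ∀ S : {S : Finset (Fin n) // S.card = i}, CoordLoc n R₀ M S.1

/-- The differential of the Čech complex:
`(d c)_S = ∑_{j ∈ S} (-1)^{#{k ∈ S : k < j}} c_{S ∖ {j}}`. -/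
def cechD (i : ℕ) :
    CechCochain n R₀ M i →ₗ[MvPolynomial (Fin n) R₀] CechCochain n R₀ M (i + 1) :=
  LinearMap.pi fun S => ∑ j : {j // j ∈ S.1},
    ((-1 : MvPolynomial (Fin n) R₀) ^ (S.1.filter (· < j.1)).card) •
      (coordLocMap n R₀ M (Finset.erase_subset j.1 S.1) ∘ₗ
        LinearMap.proj (R := MvPolynomial (Fin n) R₀)
          (φ := fun T : {T : Finset (Fin n) // T.card = i} => CoordLoc n R₀ M T.1)
          ⟨S.1.erase j.1, by rw [Finset.card_erase_of_mem j.2, S.2]; rfl⟩)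

/-- The `i`-cocycles of the Čech complex. -/
def cechCocycles (i : ℕ) :
    Submodule (MvPolynomial (Fin n) R₀) (CechCochain n R₀ M i) :=
  LinearMap.ker (cechD n R₀ M i)

/-- The `i`-coboundaries of the Čech complex. -/
def cechCoboundaries : (i : ℕ) →
    Submodule (MvPolynomial (Fin n) R₀) (CechCochain n R₀ M i)
  | 0 => ⊥
  | i + 1 => LinearMap.range (cechD n R₀ M i)

/-- The local cohomology module `H^i_{R_+}(M)`, `R = R₀[x_1, …, x_n]`, as the cohomology of
the Čech complex with respect to the generators `x_1, …, x_n` of `R_+`. -/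
abbrev LocalCohomology (i : ℕ) : Type _ :=
  cechCocycles n R₀ M i ⧸
    (cechCoboundaries n R₀ M i).submoduleOf (cechCocycles n R₀ M i)

variable {M}
variable [Module R₀ M]

/-- The degree `t` part of `M_{x_S}`, for `M` graded by `ℳ`: it is generated by the fractions
`m / s` with `s` a monomial of degree `k` in the variables `x_j`, `j ∈ S`, and `m`
homogeneous of degree `t + k`. -/
def coordLocDeg (ℳ : ℤ → Submodule R₀ M) (S : Finset (Fin n)) (t : ℤ) :
    AddSubgroup (CoordLoc n R₀ M S) :=
  AddSubgroup.closure {z | ∃ (s : coordSubmonoid R₀ S) (k : ℕ) (m : M),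
    (s : MvPolynomial (Fin n) R₀).IsHomogeneous k ∧ m ∈ ℳ (t + k) ∧ z = LocalizedModule.mk m s}

/-- The degree `t` part of the `i`-cocycles: all components are of degree `t`. -/
def cechCocyclesDeg (ℳ : ℤ → Submodule R₀ M) (i : ℕ) (t : ℤ) :
    AddSubgroup (cechCocycles n R₀ M i) where
  carrier := {c | ∀ S, c.1 S ∈ coordLocDeg n R₀ ℳ S.1 t}
  zero_mem' := fun S => (coordLocDeg n R₀ ℳ S.1 t).zero_mem
  add_mem' := fun ha hb S => (coordLocDeg n R₀ ℳ S.1 t).add_mem (ha S) (hb S)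
  neg_mem' := fun ha S => (coordLocDeg n R₀ ℳ S.1 t).neg_mem (ha S)

/-- The graded component `H^i_{R_+}(M)_t`. -/
def localCohomologyDeg (ℳ : ℤ → Submodule R₀ M) (i : ℕ) (t : ℤ) :
    AddSubgroup (LocalCohomology n R₀ M i) :=
  (cechCocyclesDeg n R₀ ℳ i t).map
    (((cechCoboundaries n R₀ M i).submoduleOf
      (cechCocycles n R₀ M i)).mkQ.toAddMonoidHom)

/-- `a_i(M) = sup {t | H^i_{R_+}(M)_t ≠ 0}`, which is `-∞` if there is no such `t`. -/
def aInv (ℳ : ℤ → Submodule R₀ M) (i : ℕ) : EReal :=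
  ⨆ (t : ℤ) (_ : localCohomologyDeg n R₀ ℳ i t ≠ ⊥), ((t : ℝ) : EReal)

/-- The Castelnuovo–Mumford regularity `max {a_i(M) + i | 0 ≤ i ≤ dim M}`. -/
def reg (ℳ : ℤ → Submodule R₀ M) : EReal :=
  ⨆ (i : ℕ) (_ : (i : WithBot ℕ∞) ≤ Module.supportDim (MvPolynomial (Fin n) R₀) M),
    (aInv n R₀ ℳ i + ((i : ℝ) : EReal))

end Module

section Hilbert

variable {M : Type*} [AddCommGroup M] [Module R₀ M]

/-- The Hilbert function `h_M(t) = ℓ_{R₀}(M_t)`. -/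
def hilbertFunction (ℳ : ℤ → Submodule R₀ M) (t : ℤ) : ℕ :=
  (Module.length R₀ (ℳ t)).toNat

/-- `e_0, …, e_{d-1}` are the Hilbert coefficients of `M`: for all large `t`,
`h_M(t) = ∑_{i=0}^{d-1} (-1)^i e_i * binom (t+d-1-i) (d-1-i)`. -/
def IsHilbertCoeff (ℳ : ℤ → Submodule R₀ M) (d : ℕ) (e : Fin d → ℤ) : Prop :=
  ∀ᶠ t : ℕ in atTop, (hilbertFunction ℳ (t : ℤ) : ℤ) =
    ∑ i : Fin d, (-1) ^ (i : ℕ) * e i * ((t + (d - 1 - i)).choose (d - 1 - i) : ℤ)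

/-- The Hilbert coefficients `e_0(M), …, e_{d-1}(M)` of a module of dimension `d`. -/
def hilbertCoeff (ℳ : ℤ → Submodule R₀ M) (d : ℕ) : Fin d → ℤ :=
  Classical.epsilon (IsHilbertCoeff ℳ d)

end Hilbert

/-- The grading of `R ⧸ I`, `R = R₀[x_1, …, x_n]`: its degree `t` part is the image of the forms
of degree `t`, and is zero for `t < 0`. -/
def quotientGrading (I : Ideal (MvPolynomial (Fin n) R₀)) (t : ℤ) :
    Submodule R₀ (MvPolynomial (Fin n) R₀ ⧸ I) :=
  if 0 ≤ t then
    (homogeneousSubmodule (Fin n) R₀ t.toNat).map (Ideal.Quotient.mkₐ R₀ I).toLinearMap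
  else ⊥

/-- The length of a ring as a module over itself. -/
def ringLength (R₀ : Type*) [CommRing R₀] : ℕ := (Module.length R₀ R₀).toNat

end CMReg

end

attribute [local instance] MvPolynomial.gradedAlgebra

/-! Cut `R/I` by generic linear forms `x_1, …, x_d`, and let `r ≥ 0` be such that `H^i(R/I)_t = 0`
whenever `i ≤ d` and `t + i > r`. Since the residue field is infinite, each form can be taken
filter-regular: its kernel by multiplication is `R_+`-torsion. The long exact sequence then passes
the vanishing above `r` on to every section (`localCohomologyDeg_quotient_eq_bot`,
`VanishesAbove.sup_span`).

Let `h_D` be the Hilbert function of the section by `d - D` forms. Beyond degree `r` there is no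
torsion, so multiplication by the next form is injective and `h_{D+1}(t+1) - h_{D+1}(t) = h_D(t+1)`
for `t > r`; moreover `h_0(t) = 0` there. Hence `h_D` agrees for `t > r` with a polynomial `P_D`,
and `P_{D+1}(t) - P_{D+1}(t-1) = P_D(t)` identically. At `t = r` injectivity may fail, but
`P_{D+1}(r)` is still the length of an image of multiplication by a linear form, so `0 ≤ P_{D+1}(r)
≤ h_{D+1}(r)`. Each form eliminates one variable, so this is at most `ℓ(R₀) * binom (c+D+r) r`
(`sectionHilbert_le`).

The coefficients are values at `-1`: `(-1)^D e_D = P_{D+1}(-1)`. Descending from `r` to `-1` by the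
difference equation bounds them (`iterated_sum_bounds`): `e_0 ≤ ℓ(R₀) * binom (c+r) r` and `|e_D| ≤
ℓ(R₀) * (r+1)^(c+D)`. The second is (b); the first gives (a) by the inequality of arithmetic and
geometric means applied to `(r+1)⋯(r+c)`. -/

noncomputable section

namespace CMReg

open MvPolynomial Filter

/-! ### Čech cohomology: functoriality, grading and the long exact sequence -/

section Cech

variable {n : ℕ} {R₀ : Type*} [CommRing R₀]
variable {M : Type*} [AddCommGroup M] [Module (MvPolynomial (Fin n) R₀) M]
variable {N : Type*} [AddCommGroup N] [Module (MvPolynomial (Fin n) R₀) N]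

theorem coordLocMap_mk {S T : Finset (Fin n)} (h : S ⊆ T) (m : M) (s : coordSubmonoid R₀ S) :
    coordLocMap n R₀ M h (LocalizedModule.mk m s) =
      LocalizedModule.mk m ⟨s.1, coordSubmonoid_mono h s.2⟩ := by
  rw [IsLocalizedModule.mk_eq_mk', IsLocalizedModule.mk_eq_mk', coordLocMap,
    LocalizedModule.liftOfLE, IsLocalizedModule.liftOfLE_mk']

theorem coordLocMap_coordLocMap {S T U : Finset (Fin n)} (h : S ⊆ T) (h' : T ⊆ U)
    (z : CoordLoc n R₀ M S) :
    coordLocMap n R₀ M h' (coordLocMap n R₀ M h z) = coordLocMap n R₀ M (h.trans h') z := by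
  induction z using LocalizedModule.induction_on with
  | h m s => simp only [coordLocMap_mk]

theorem coordLocMap_congr {i : ℕ} (c : CechCochain n R₀ M i) {S T U : Finset (Fin n)}
    (hST : S = T) (hS : S.card = i) (hT : T.card = i) (h : S ⊆ U) (h' : T ⊆ U) :
    coordLocMap n R₀ M h (c ⟨S, hS⟩) = coordLocMap n R₀ M h' (c ⟨T, hT⟩) := by
  subst hST; rfl

theorem cechD_apply {i : ℕ} (c : CechCochain n R₀ M i)
    (S : {S : Finset (Fin n) // S.card = i + 1}) :
    cechD n R₀ M i c S = ∑ j : {j // j ∈ S.1},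
      ((-1 : MvPolynomial (Fin n) R₀) ^ (S.1.filter (· < j.1)).card) •
        coordLocMap n R₀ M (Finset.erase_subset j.1 S.1)
          (c ⟨S.1.erase j.1, by rw [Finset.card_erase_of_mem j.2, S.2]; rfl⟩) := by
  simp [cechD]

theorem erase_sign {S : Finset (Fin n)} {j k : Fin n} (hk : k ∈ S) (hkj : k < j) :
    (-1 : MvPolynomial (Fin n) R₀) ^ (S.filter (· < j)).card *
        (-1) ^ ((S.erase j).filter (· < k)).card +
      (-1) ^ (S.filter (· < k)).card * (-1) ^ ((S.erase k).filter (· < j)).card = 0 := by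
  have h1 : (S.erase j).filter (· < k) = S.filter (· < k) := by
    ext a
    simp only [Finset.mem_filter, Finset.mem_erase]
    constructor
    · rintro ⟨⟨_, h⟩, h'⟩; exact ⟨h, h'⟩
    · rintro ⟨h, h'⟩; exact ⟨⟨(h'.trans hkj).ne, h⟩, h'⟩
  have h2 : (S.filter (· < j)).card = ((S.erase k).filter (· < j)).card + 1 := by
    rw [Finset.filter_erase, Finset.card_erase_add_one]
    simp [hk, hkj]
  rw [h1, h2, pow_succ]
  ring

/-- Removing `j` then `k` and removing `k` then `j` give the same component with opposite signs
(`erase_sign`), so the double sum cancels under this involution. -/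
theorem cechD_cechD {i : ℕ} (c : CechCochain n R₀ M i) :
    cechD n R₀ M (i + 1) (cechD n R₀ M i c) = 0 := by
  funext S
  rw [cechD_apply]
  simp only [cechD_apply, map_sum, map_smul, Finset.smul_sum, smul_smul, coordLocMap_coordLocMap]
  rw [Finset.sum_sigma']
  have key : ∀ (j k : Fin n) (hj : j ∈ S.1) (hk : k ∈ S.1) (hjk : k ≠ j)
      (h₁ : ((S.1.erase j).erase k).card = i) (h₂ : ((S.1.erase k).erase j).card = i)
      (h₃ : (S.1.erase j).erase k ⊆ S.1) (h₄ : (S.1.erase k).erase j ⊆ S.1),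
      (((-1 : MvPolynomial (Fin n) R₀) ^ (S.1.filter (· < j)).card *
        (-1) ^ ((S.1.erase j).filter (· < k)).card) •
          coordLocMap n R₀ M h₃ (c ⟨(S.1.erase j).erase k, h₁⟩)) +
      (((-1 : MvPolynomial (Fin n) R₀) ^ (S.1.filter (· < k)).card *
        (-1) ^ ((S.1.erase k).filter (· < j)).card) •
          coordLocMap n R₀ M h₄ (c ⟨(S.1.erase k).erase j, h₂⟩)) = 0 := by
    intro j k hj hk hjk h₁ h₂ h₃ h₄
    rw [coordLocMap_congr c (Finset.erase_right_comm) h₁ h₂ h₃ h₄, ← add_smul]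
    rcases lt_or_gt_of_ne hjk with h | h
    · rw [erase_sign hk h, zero_smul]
    · have := erase_sign (R₀ := R₀) hj h
      rw [add_comm] at this
      rw [this, zero_smul]
  refine Finset.sum_involution
    (fun a _ => ⟨⟨a.2.1, Finset.mem_of_mem_erase a.2.2⟩,
      ⟨a.1.1, Finset.mem_erase.2 ⟨(Finset.ne_of_mem_erase a.2.2).symm, a.1.2⟩⟩⟩) ?_ ?_ ?_ ?_
  · rintro ⟨⟨j, hj⟩, ⟨k, hk⟩⟩ _
    exact key j k hj (Finset.mem_of_mem_erase hk) (Finset.ne_of_mem_erase hk) _ _ _ _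
  · rintro ⟨⟨j, hj⟩, ⟨k, hk⟩⟩ _ _ h
    exact Finset.ne_of_mem_erase hk (congrArg (fun a => a.1.1) h)
  · intros; exact Finset.mem_univ _
  · rintro ⟨⟨j, hj⟩, ⟨k, hk⟩⟩ _; rfl

/-- The map induced by `g` on localizations at monomials. -/
def coordLocFun (g : M →ₗ[MvPolynomial (Fin n) R₀] N) (S : Finset (Fin n)) :
    CoordLoc n R₀ M S →ₗ[MvPolynomial (Fin n) R₀] CoordLoc n R₀ N S :=
  IsLocalizedModule.map (coordSubmonoid R₀ S) (LocalizedModule.mkLinearMap _ M)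
    (LocalizedModule.mkLinearMap _ N) g

theorem coordLocFun_mk (g : M →ₗ[MvPolynomial (Fin n) R₀] N) (S : Finset (Fin n)) (m : M)
    (s : coordSubmonoid R₀ S) :
    coordLocFun g S (LocalizedModule.mk m s) = LocalizedModule.mk (g m) s :=
  IsLocalizedModule.map_LocalizedModules _ g m s

theorem coordLocFun_coordLocMap (g : M →ₗ[MvPolynomial (Fin n) R₀] N) {S T : Finset (Fin n)}
    (h : S ⊆ T) (z : CoordLoc n R₀ M S) :
    coordLocFun g T (coordLocMap n R₀ M h z) = coordLocMap n R₀ N h (coordLocFun g S z) := by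
  induction z using LocalizedModule.induction_on with
  | h m s => simp only [coordLocMap_mk, coordLocFun_mk]

/-- The map induced by `g` on Čech cochains. -/
def cechMap (g : M →ₗ[MvPolynomial (Fin n) R₀] N) (i : ℕ) :
    CechCochain n R₀ M i →ₗ[MvPolynomial (Fin n) R₀] CechCochain n R₀ N i :=
  LinearMap.pi fun S => coordLocFun g S.1 ∘ₗ LinearMap.proj S

theorem cechMap_apply (g : M →ₗ[MvPolynomial (Fin n) R₀] N) {i : ℕ} (c : CechCochain n R₀ M i)
    (S : {S : Finset (Fin n) // S.card = i}) : cechMap g i c S = coordLocFun g S.1 (c S) := rfl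

theorem cechMap_cechD (g : M →ₗ[MvPolynomial (Fin n) R₀] N) {i : ℕ} (c : CechCochain n R₀ M i) :
    cechMap g (i + 1) (cechD n R₀ M i c) = cechD n R₀ N i (cechMap g i c) := by
  funext S
  simp only [cechMap_apply, cechD_apply, map_sum, map_smul, coordLocFun_coordLocMap]

theorem cechMap_mem_coboundaries (g : M →ₗ[MvPolynomial (Fin n) R₀] N) {i : ℕ}
    {c : CechCochain n R₀ M i} (hc : c ∈ cechCoboundaries n R₀ M i) :
    cechMap g i c ∈ cechCoboundaries n R₀ N i := by
  cases i with
  | zero =>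
    have : c = 0 := hc
    rw [this, map_zero]
    exact Submodule.zero_mem _
  | succ i =>
    obtain ⟨a, rfl⟩ := hc
    exact ⟨cechMap g i a, (cechMap_cechD g a).symm⟩

theorem exists_monomial_of_mem_coordSubmonoid {S : Finset (Fin n)} {s : MvPolynomial (Fin n) R₀}
    (hs : s ∈ coordSubmonoid R₀ S) : ∃ e, s = monomial e 1 := by
  induction hs using Submonoid.closure_induction with
  | mem x hx =>
    obtain ⟨j, -, rfl⟩ := hx
    exact ⟨_, rfl⟩
  | one => exact ⟨0, rfl⟩
  | mul x y _ _ hx hy =>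
    obtain ⟨e, rfl⟩ := hx
    obtain ⟨f, rfl⟩ := hy
    exact ⟨e + f, by simp [monomial_mul]⟩

theorem isHomogeneous_of_mem_coordSubmonoid {S : Finset (Fin n)} {s : MvPolynomial (Fin n) R₀}
    (hs : s ∈ coordSubmonoid R₀ S) : s.IsHomogeneous s.totalDegree := by
  obtain ⟨e, rfl⟩ := exists_monomial_of_mem_coordSubmonoid hs
  rcases subsingleton_or_nontrivial R₀ with h | h
  · rw [Subsingleton.elim (monomial e (1 : R₀)) 0]
    exact isHomogeneous_zero _ _ _
  · rw [totalDegree_monomial _ one_ne_zero]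
    exact isHomogeneous_monomial _ rfl

theorem totalDegree_of_mem_coordSubmonoid [Nontrivial R₀] {S : Finset (Fin n)}
    {s : MvPolynomial (Fin n) R₀} (hs : s ∈ coordSubmonoid R₀ S) {k : ℕ} (hk : s.IsHomogeneous k) :
    s.totalDegree = k := by
  obtain ⟨e, rfl⟩ := exists_monomial_of_mem_coordSubmonoid hs
  exact hk.totalDegree (by simp)

theorem mk_add_same {S : Finset (Fin n)} (m m' : M) (s : coordSubmonoid R₀ S) :
    LocalizedModule.mk (m + m') s = LocalizedModule.mk m s + LocalizedModule.mk m' s := by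
  simp only [IsLocalizedModule.mk_eq_mk', IsLocalizedModule.mk'_add]

theorem exists_common_denom {S : Finset (Fin n)} (z w : CoordLoc n R₀ M S) :
    ∃ (m m' : M) (s : coordSubmonoid R₀ S),
      z = LocalizedModule.mk m s ∧ w = LocalizedModule.mk m' s := by
  induction z using LocalizedModule.induction_on with
  | h m s =>
    induction w using LocalizedModule.induction_on with
    | h m' s' =>
      exact ⟨s' • m, s • m', s' * s, (LocalizedModule.mk_cancel_common_left s' s m).symm, by
        rw [mul_comm]; exact (LocalizedModule.mk_cancel_common_left s s' m').symm⟩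

theorem neg_one_pow_smul {A G : Type*} [Ring A] [AddCommGroup G] [Module A G] (k : ℕ) (z : G) :
    ((-1 : A) ^ k) • z = (-1 : ℤ) ^ k • z := by
  rcases Nat.even_or_odd k with h | h <;> simp [h.neg_one_pow]

theorem neg_one_pow_smul_mem {A G : Type*} [Ring A] [AddCommGroup G] [Module A G]
    (H : AddSubgroup G) (k : ℕ) {z : G} (hz : z ∈ H) : ((-1 : A) ^ k) • z ∈ H := by
  rw [neg_one_pow_smul]
  exact zsmul_mem hz _

theorem mk_eq_zero_of_smul {S : Finset (Fin n)} {m : M} {u : MvPolynomial (Fin n) R₀}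
    (hu : u ∈ coordSubmonoid R₀ S) (h : u • m = 0) (s : coordSubmonoid R₀ S) :
    (LocalizedModule.mk m s : CoordLoc n R₀ M S) = 0 := by
  rw [← LocalizedModule.zero_mk s, LocalizedModule.mk_eq]
  refine ⟨⟨u, hu⟩, ?_⟩
  simp only [Submonoid.smul_def, smul_zero]
  rw [smul_comm, h, smul_zero]

theorem exists_smul_eq_zero_of_mk {S : Finset (Fin n)} {m : M} {s : coordSubmonoid R₀ S}
    (h : (LocalizedModule.mk m s : CoordLoc n R₀ M S) = 0) :
    ∃ u ∈ coordSubmonoid R₀ S, u • m = 0 := by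
  rw [← LocalizedModule.zero_mk s, LocalizedModule.mk_eq] at h
  obtain ⟨u, hu⟩ := h
  refine ⟨u * s, mul_mem u.2 s.2, ?_⟩
  simpa [Submonoid.smul_def, smul_smul] using hu

/-- `p t` is the projection of `M` onto its degree `t` part. -/
structure IsGradedProj [Module R₀ M] (ℳ : ℤ → Submodule R₀ M) (p : ℤ → M → M) : Prop where
  add : ∀ t a b, p t (a + b) = p t a + p t b
  mem : ∀ t a, p t a ∈ ℳ t
  eq_self : ∀ t a, a ∈ ℳ t → p t a = a
  smul : ∀ (t : ℤ) (k : ℕ) (f : MvPolynomial (Fin n) R₀) (a : M), f.IsHomogeneous k →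
    p (t + k) (f • a) = f • p t a

section Graded

variable [Module R₀ M] [Module R₀ N] {ℳ : ℤ → Submodule R₀ M} {p : ℤ → M → M}
  {𝒩 : ℤ → Submodule R₀ N}

/-- The projection of `M_{x_S}` onto its degree `t` part. -/
def locProj (hp : IsGradedProj (n := n) ℳ p) (S : Finset (Fin n)) (t : ℤ)
    (z : CoordLoc n R₀ M S) : CoordLoc n R₀ M S :=
  LocalizedModule.liftOn z
    (fun a => LocalizedModule.mk (p (t + (a.2.1.totalDegree : ℕ)) a.1) a.2) (by
      rintro ⟨m, s⟩ ⟨m', s'⟩ ⟨u, hu⟩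
      dsimp only
      rw [LocalizedModule.mk_eq]
      rcases subsingleton_or_nontrivial R₀ with h | h
      · exact ⟨1, @Subsingleton.elim _ (Module.subsingleton R₀ M) _ _⟩
      refine ⟨u, ?_⟩
      simp only [Submonoid.smul_def, smul_smul] at hu ⊢
      have hus := mul_mem u.2 s.2
      have hus' := mul_mem u.2 s'.2
      -- Degrees of monomials add, so cross-multiplying the two fractions by `u * s'` and `u * s`
      -- lands in the same degree `t + deg u + deg s + deg s'`.
      have e := totalDegree_of_mem_coordSubmonoid hus ((isHomogeneous_of_mem_coordSubmonoid u.2).mul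
        (isHomogeneous_of_mem_coordSubmonoid s.2))
      have e' := totalDegree_of_mem_coordSubmonoid hus'
        ((isHomogeneous_of_mem_coordSubmonoid u.2).mul (isHomogeneous_of_mem_coordSubmonoid s'.2))
      rw [← hp.smul _ _ _ _ (isHomogeneous_of_mem_coordSubmonoid hus),
        ← hp.smul _ _ _ _ (isHomogeneous_of_mem_coordSubmonoid hus'), hu, e, e']
      exact congrArg (fun z => p z _) (by push_cast; ring))

theorem locProj_mk (hp : IsGradedProj (n := n) ℳ p) (S : Finset (Fin n)) (t : ℤ) (m : M)
    (s : coordSubmonoid R₀ S) : locProj hp S t (LocalizedModule.mk m s) =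
      LocalizedModule.mk (p (t + (s.1.totalDegree : ℕ)) m) s :=
  rfl

theorem locProj_add (hp : IsGradedProj (n := n) ℳ p) (S : Finset (Fin n)) (t : ℤ)
    (z w : CoordLoc n R₀ M S) : locProj hp S t (z + w) = locProj hp S t z + locProj hp S t w := by
  obtain ⟨m, m', s, rfl, rfl⟩ := exists_common_denom z w
  rw [← mk_add_same, locProj_mk, locProj_mk, locProj_mk, ← mk_add_same, hp.add]

/-- `locProj` as an additive map. -/
def locProjHom (hp : IsGradedProj (n := n) ℳ p) (S : Finset (Fin n)) (t : ℤ) :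
    CoordLoc n R₀ M S →+ CoordLoc n R₀ M S :=
  AddMonoidHom.mk' (locProj hp S t) (locProj_add hp S t)

theorem locProjHom_mk (hp : IsGradedProj (n := n) ℳ p) (S : Finset (Fin n)) (t : ℤ) (m : M)
    (s : coordSubmonoid R₀ S) : locProjHom hp S t (LocalizedModule.mk m s) =
      LocalizedModule.mk (p (t + (s.1.totalDegree : ℕ)) m) s :=
  rfl

theorem locProjHom_mem (hp : IsGradedProj (n := n) ℳ p) (S : Finset (Fin n)) (t : ℤ)
    (z : CoordLoc n R₀ M S) : locProjHom hp S t z ∈ coordLocDeg n R₀ ℳ S t := by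
  induction z using LocalizedModule.induction_on with
  | h m s =>
    rw [locProjHom_mk]
    exact AddSubgroup.subset_closure
      ⟨s, _, _, isHomogeneous_of_mem_coordSubmonoid s.2, hp.mem _ _, rfl⟩

theorem locProjHom_eq_self [Nontrivial R₀] (hp : IsGradedProj (n := n) ℳ p) (S : Finset (Fin n))
    (t : ℤ) {z : CoordLoc n R₀ M S} (hz : z ∈ coordLocDeg n R₀ ℳ S t) :
    locProjHom hp S t z = z := by
  induction hz using AddSubgroup.closure_induction with
  | mem z hz =>
    obtain ⟨s, k, m, hs, hm, rfl⟩ := hz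
    rw [locProjHom_mk, totalDegree_of_mem_coordSubmonoid s.2 hs, hp.eq_self _ _ hm]
  | zero => exact map_zero _
  | add z w _ _ hz hw => rw [map_add, hz, hw]
  | neg z _ hz => rw [map_neg, hz]

theorem locProjHom_coordLocMap (hp : IsGradedProj (n := n) ℳ p) {S T : Finset (Fin n)} (h : S ⊆ T)
    (t : ℤ) (z : CoordLoc n R₀ M S) : locProjHom hp T t (coordLocMap n R₀ M h z) =
      coordLocMap n R₀ M h (locProjHom hp S t z) := by
  induction z using LocalizedModule.induction_on with
  | h m s => simp only [coordLocMap_mk, locProjHom_mk]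

theorem locProjHom_smul (hp : IsGradedProj (n := n) ℳ p) (S : Finset (Fin n)) (t : ℤ) {k : ℕ}
    {f : MvPolynomial (Fin n) R₀} (hf : f.IsHomogeneous k) (z : CoordLoc n R₀ M S) :
    locProjHom hp S (t + k) (f • z) = f • locProjHom hp S t z := by
  induction z using LocalizedModule.induction_on with
  | h m s =>
    rw [LocalizedModule.smul'_mk, locProjHom_mk, locProjHom_mk, LocalizedModule.smul'_mk,
      ← hp.smul _ _ _ _ hf, add_right_comm]

theorem coordLocMap_mem {S T : Finset (Fin n)} (h : S ⊆ T) {t : ℤ} {z : CoordLoc n R₀ M S}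
    (hz : z ∈ coordLocDeg n R₀ ℳ S t) : coordLocMap n R₀ M h z ∈ coordLocDeg n R₀ ℳ T t := by
  induction hz using AddSubgroup.closure_induction with
  | mem z hz =>
    obtain ⟨s, k, m, hs, hm, rfl⟩ := hz
    rw [coordLocMap_mk]
    exact AddSubgroup.subset_closure ⟨_, k, m, hs, hm, rfl⟩
  | zero => rw [map_zero]; exact zero_mem _
  | add z w _ _ hz hw => rw [map_add]; exact add_mem hz hw
  | neg z _ hz => rw [map_neg]; exact neg_mem hz

theorem cechD_mem {i : ℕ} {t : ℤ} {c : CechCochain n R₀ M i}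
    (hc : ∀ S : {S : Finset (Fin n) // S.card = i}, c S ∈ coordLocDeg n R₀ ℳ S.1 t)
    (S : {S : Finset (Fin n) // S.card = i + 1}) :
    cechD n R₀ M i c S ∈ coordLocDeg n R₀ ℳ S.1 t := by
  rw [cechD_apply]
  refine AddSubgroup.sum_mem _ fun j _ => ?_
  have := coordLocMap_mem (Finset.erase_subset j.1 S.1)
    (hc ⟨S.1.erase j.1, by rw [Finset.card_erase_of_mem j.2, S.2]; rfl⟩)
  exact neg_one_pow_smul_mem _ _ this

theorem locProjHom_cechD (hp : IsGradedProj (n := n) ℳ p) {i : ℕ} (t : ℤ)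
    (c : CechCochain n R₀ M i) (S : {S : Finset (Fin n) // S.card = i + 1}) :
    locProjHom hp S.1 t (cechD n R₀ M i c S) =
      cechD n R₀ M i (fun T => locProjHom hp T.1 t (c T)) S := by
  simp only [cechD_apply, neg_one_pow_smul, map_sum, map_zsmul, locProjHom_coordLocMap]

/-- The coboundary condition asks for no homogeneous primitive; where one is needed, the degree
projections `locProjHom` supply it. -/
theorem localCohomologyDeg_eq_bot_iff {i : ℕ} {t : ℤ} :
    localCohomologyDeg n R₀ ℳ i t = ⊥ ↔ ∀ c : CechCochain n R₀ M i,
      c ∈ cechCocycles n R₀ M i → (∀ S, c S ∈ coordLocDeg n R₀ ℳ S.1 t) →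
        c ∈ cechCoboundaries n R₀ M i := by
  rw [localCohomologyDeg, AddSubgroup.map_eq_bot_iff]
  constructor
  · intro h c hc hct
    have h' := h (show (⟨c, hc⟩ : cechCocycles n R₀ M i) ∈ cechCocyclesDeg n R₀ ℳ i t from hct)
    rw [AddMonoidHom.mem_ker] at h'
    have h'' : (⟨c, hc⟩ : cechCocycles n R₀ M i) ∈
        (cechCoboundaries n R₀ M i).submoduleOf (cechCocycles n R₀ M i) :=
      (Submodule.Quotient.mk_eq_zero _).1 h'
    exact h''
  · intro h c hc
    rw [AddMonoidHom.mem_ker]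
    have h' : c ∈ (cechCoboundaries n R₀ M i).submoduleOf (cechCocycles n R₀ M i) :=
      h c.1 c.2 hc
    exact (Submodule.Quotient.mk_eq_zero _).2 h'

/-- If `H^0_{R_+}(M)_t = 0` then `M_t` has no nonzero elements killed by a power of `R_+`. -/
theorem eq_zero_of_localCohomologyDeg_zero {t : ℤ} (h : localCohomologyDeg n R₀ ℳ 0 t = ⊥) {m : M}
    (hm : m ∈ ℳ t) (htors : ∀ j, ∃ k : ℕ, (X j ^ k : MvPolynomial (Fin n) R₀) • m = 0) :
    m = 0 := by
  rw [localCohomologyDeg_eq_bot_iff] at h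
  have hb := h (fun S => LocalizedModule.mk m 1) ?_ ?_
  · have h0 := congrFun (show _ = (0 : CechCochain n R₀ M 0) from hb) ⟨∅, rfl⟩
    obtain ⟨u, hu, hum⟩ := exists_smul_eq_zero_of_mk h0
    have : u = 1 := by simpa [coordSubmonoid] using hu
    rwa [this, one_smul] at hum
  · rw [cechCocycles, LinearMap.mem_ker]
    funext S
    rw [cechD_apply]
    refine Finset.sum_eq_zero fun j _ => ?_
    obtain ⟨k, hk⟩ := htors j
    rw [coordLocMap_mk, mk_eq_zero_of_smul _ hk, smul_zero]
    exact pow_mem (Submonoid.subset_closure (Set.mem_image_of_mem _ j.2)) k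
  · intro S
    exact AddSubgroup.subset_closure ⟨1, 0, m, isHomogeneous_one _ _, by simpa using hm, rfl⟩

/-- The part of the long exact cohomology sequence of multiplication by a linear form `x` with
`0 :_M x` of finite length. -/
theorem localCohomologyDeg_quotient_eq_bot [Nontrivial R₀] (hp : IsGradedProj (n := n) ℳ p)
    {x : MvPolynomial (Fin n) R₀} (hx : x.IsHomogeneous 1)
    (g : M →ₗ[MvPolynomial (Fin n) R₀] N) (hg : ∀ t, ∀ y ∈ 𝒩 t, ∃ m ∈ ℳ t, g m = y)
    (hker : ∀ m, g m = 0 ↔ ∃ m', x • m' = m)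
    (htors : ∀ m : M, x • m = 0 → ∀ j, ∃ k : ℕ, (X j ^ k : MvPolynomial (Fin n) R₀) • m = 0)
    {i : ℕ} {t : ℤ} (h₀ : localCohomologyDeg n R₀ ℳ i t = ⊥)
    (h₁ : localCohomologyDeg n R₀ ℳ (i + 1) (t - 1) = ⊥) :
    localCohomologyDeg n R₀ 𝒩 i t = ⊥ := by
  rw [localCohomologyDeg_eq_bot_iff] at h₀ h₁ ⊢
  intro c hc hct
  have hshift : ∀ (S : Finset (Fin n)) (z : CoordLoc n R₀ M S),
      locProjHom hp S t (x • z) = x • locProjHom hp S (t - 1) z := fun S z => by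
    have := locProjHom_smul hp S (t - 1) hx z
    rwa [Nat.cast_one, sub_add_cancel] at this
  -- Diagram chase: lift the cocycle `c` to a cochain `a` of `M` in degree `t`, write `d a = x b`,
  -- show that `b` is a cocycle of degree `t - 1`, write `b = d a''`, and correct `a` to the cocycle
  -- `a - x a''`.
  have hlift : ∀ S : {S : Finset (Fin n) // S.card = i}, ∃ z ∈ coordLocDeg n R₀ ℳ S.1 t,
      coordLocFun g S.1 z = c S := fun S => by
    generalize c S = w, hct S = hw
    induction hw using AddSubgroup.closure_induction with
    | mem w hw =>
      obtain ⟨s, k, y, hs, hy, rfl⟩ := hw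
      obtain ⟨m, hm, rfl⟩ := hg _ _ hy
      exact ⟨LocalizedModule.mk m s, AddSubgroup.subset_closure ⟨s, k, m, hs, hm, rfl⟩,
        coordLocFun_mk _ _ _ _⟩
    | zero => exact ⟨0, zero_mem _, map_zero _⟩
    | add w w' _ _ hw hw' =>
      obtain ⟨z, hz, rfl⟩ := hw
      obtain ⟨z', hz', rfl⟩ := hw'
      exact ⟨z + z', add_mem hz hz', map_add _ _ _⟩
    | neg w _ hw =>
      obtain ⟨z, hz, rfl⟩ := hw
      exact ⟨-z, neg_mem hz, map_neg _ _⟩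
  choose a ha hac using hlift
  have hac' : cechMap g i a = c := funext hac
  have hdiv : ∀ T : {T : Finset (Fin n) // T.card = i + 1},
      ∃ b ∈ coordLocDeg n R₀ ℳ T.1 (t - 1), x • b = cechD n R₀ M i a T := fun T => by
    have hzero : coordLocFun g T.1 (cechD n R₀ M i a T) = 0 := by
      rw [← cechMap_apply, cechMap_cechD, hac', LinearMap.mem_ker.1 hc]; rfl
    have hex : ∃ b, x • b = cechD n R₀ M i a T := by
      revert hzero
      generalize cechD n R₀ M i a T = z
      induction z using LocalizedModule.induction_on with
      | h m s =>
        intro hzero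
        rw [coordLocFun_mk] at hzero
        obtain ⟨u, hu, hum⟩ := exists_smul_eq_zero_of_mk hzero
        rw [← map_smul] at hum
        obtain ⟨m', hm'⟩ := (hker _).1 hum
        refine ⟨LocalizedModule.mk m' (⟨u, hu⟩ * s), ?_⟩
        rw [LocalizedModule.smul'_mk, hm']
        exact LocalizedModule.mk_cancel_common_left ⟨u, hu⟩ s m
    obtain ⟨b, hb⟩ := hex
    -- The quotient `b` need not be homogeneous, but `d a` has degree `t`, so the degree `t - 1`
    -- part of `b` is also a quotient.
    refine ⟨locProjHom hp T.1 (t - 1) b, locProjHom_mem _ _ _ _, ?_⟩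
    rw [← hshift, hb, locProjHom_eq_self hp _ _ (cechD_mem ha T)]
  choose b hb hxb using hdiv
  have hxb' : x • b = cechD n R₀ M i a := funext hxb
  have hbz : b ∈ cechCocycles n R₀ M (i + 1) := by
    rw [cechCocycles, LinearMap.mem_ker]
    have hxdb : x • cechD n R₀ M (i + 1) b = 0 := by rw [← map_smul, hxb', cechD_cechD]
    funext T
    have hT : x • cechD n R₀ M (i + 1) b T = 0 := congrFun hxdb T
    revert hT
    generalize cechD n R₀ M (i + 1) b T = z
    induction z using LocalizedModule.induction_on with
    | h m s =>
      intro hT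
      rw [LocalizedModule.smul'_mk] at hT
      obtain ⟨u, hu, hum⟩ := exists_smul_eq_zero_of_mk hT
      rw [smul_comm] at hum
      -- The components of `d b` are indexed by sets of size `i + 2`, so some variable is inverted
      -- there and kills the torsion annihilated by `x`.
      obtain ⟨j, hj⟩ : T.1.Nonempty := by
        rw [← Finset.card_pos, T.2]; omega
      obtain ⟨k, hk⟩ := htors _ hum j
      rw [smul_smul] at hk
      exact mk_eq_zero_of_smul
        (mul_mem (pow_mem (Submonoid.subset_closure (Set.mem_image_of_mem _ hj)) k) hu) hk s
  obtain ⟨a', ha'⟩ := h₁ b hbz hb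
  set a'' : CechCochain n R₀ M i := fun S => locProjHom hp S.1 (t - 1) (a' S) with ha''
  have hda'' : cechD n R₀ M i a'' = b := by
    funext T
    rw [ha'', ← locProjHom_cechD, ha', locProjHom_eq_self hp _ _ (hb T)]
  have hbd := h₀ (a - x • a'') ?_ ?_
  · have := cechMap_mem_coboundaries g hbd
    rw [map_sub, hac'] at this
    convert this
    rw [eq_comm, sub_eq_self]
    funext S
    rw [map_smul]
    change x • coordLocFun g S.1 (a'' S) = 0
    generalize a'' S = z
    induction z using LocalizedModule.induction_on with
    | h m s =>
      rw [coordLocFun_mk, LocalizedModule.smul'_mk, ← map_smul, (hker _).2 ⟨m, rfl⟩,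
        LocalizedModule.zero_mk]
  · rw [cechCocycles, LinearMap.mem_ker, map_sub, map_smul, hda'', hxb', sub_self]
  · intro S
    refine sub_mem (ha S) ?_
    change x • locProjHom hp S.1 (t - 1) (a' S) ∈ _
    rw [← hshift]
    exact locProjHom_mem _ _ _ _

end Graded

end Cech

/-! ### The grading of a quotient ring and vanishing under a hyperplane section -/

section QuotientGrading

variable {n : ℕ} {R₀ : Type*} [CommRing R₀]

theorem coe_decompose_eq_homogeneousComponent (f : MvPolynomial (Fin n) R₀) (t : ℕ) :
    (DirectSum.decompose (homogeneousSubmodule (Fin n) R₀) f t : MvPolynomial (Fin n) R₀) =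
      homogeneousComponent t f :=
  decomposition.decompose'_apply f t

theorem homogeneousComponent_mul_of_isHomogeneous {f : MvPolynomial (Fin n) R₀} {k : ℕ}
    (hf : f.IsHomogeneous k) (g : MvPolynomial (Fin n) R₀) (t : ℕ) :
    homogeneousComponent (t + k) (f * g) = f * homogeneousComponent t g := by
  have := DirectSum.coe_decompose_mul_of_left_mem (homogeneousSubmodule (Fin n) R₀) (b := g)
    (t + k) (show f ∈ homogeneousSubmodule (Fin n) R₀ k from hf)
  rw [if_pos (Nat.le_add_left _ _), Nat.add_sub_cancel] at this
  simpa only [coe_decompose_eq_homogeneousComponent] using this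

theorem homogeneousComponent_mul_of_lt {f : MvPolynomial (Fin n) R₀} {k : ℕ}
    (hf : f.IsHomogeneous k) (g : MvPolynomial (Fin n) R₀) {t : ℕ} (ht : t < k) :
    homogeneousComponent t (f * g) = 0 := by
  have := DirectSum.coe_decompose_mul_of_left_mem (homogeneousSubmodule (Fin n) R₀) (b := g)
    t (show f ∈ homogeneousSubmodule (Fin n) R₀ k from hf)
  rw [if_neg (not_le.2 ht)] at this
  simpa only [coe_decompose_eq_homogeneousComponent] using this

theorem mk_mem_quotientGrading (J : Ideal (MvPolynomial (Fin n) R₀))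
    {f : MvPolynomial (Fin n) R₀} {k : ℕ} (hf : f.IsHomogeneous k) :
    Ideal.Quotient.mk J f ∈ quotientGrading J (k : ℤ) := by
  rw [quotientGrading, if_pos (Int.natCast_nonneg k)]
  exact ⟨f, hf, rfl⟩

theorem exists_of_mem_quotientGrading {J : Ideal (MvPolynomial (Fin n) R₀)} {k : ℕ}
    {m : MvPolynomial (Fin n) R₀ ⧸ J} (hm : m ∈ quotientGrading J (k : ℤ)) :
    ∃ f : MvPolynomial (Fin n) R₀, f.IsHomogeneous k ∧ Ideal.Quotient.mk J f = m := by
  rw [quotientGrading, if_pos (Int.natCast_nonneg k)] at hm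
  obtain ⟨f, hf, rfl⟩ := hm
  exact ⟨f, hf, rfl⟩

theorem eq_zero_of_mem_quotientGrading_of_neg {J : Ideal (MvPolynomial (Fin n) R₀)} {t : ℤ}
    (ht : t < 0) {m : MvPolynomial (Fin n) R₀ ⧸ J} (hm : m ∈ quotientGrading J t) : m = 0 := by
  rw [quotientGrading, if_neg (not_le.2 ht)] at hm
  exact hm

/-- The projection of `R ⧸ J` onto its degree `t` part. -/
def quotientProj (J : Ideal (MvPolynomial (Fin n) R₀)) (t : ℤ)
    (m : MvPolynomial (Fin n) R₀ ⧸ J) : MvPolynomial (Fin n) R₀ ⧸ J :=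
  if 0 ≤ t then Ideal.Quotient.mk J (homogeneousComponent t.toNat (Quotient.out m)) else 0

variable {J : Ideal (MvPolynomial (Fin n) R₀)}

/-- Homogeneity of `J` makes the component independent of the representative chosen by
`Quotient.out`. -/
theorem quotientProj_mk (hJ : J.IsHomogeneous (homogeneousSubmodule (Fin n) R₀)) (t : ℤ)
    (f : MvPolynomial (Fin n) R₀) : quotientProj J t (Ideal.Quotient.mk J f) =
      if 0 ≤ t then Ideal.Quotient.mk J (homogeneousComponent t.toNat f) else 0 := by
  unfold quotientProj
  congr 1
  rw [Ideal.Quotient.eq, ← map_sub]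
  refine homogeneousComponent_mem_of_mem hJ ?_ _
  rw [← Ideal.Quotient.eq]
  exact Quotient.out_eq _

theorem isGradedProj_quotientProj (hJ : J.IsHomogeneous (homogeneousSubmodule (Fin n) R₀)) :
    IsGradedProj (n := n) (quotientGrading J) (quotientProj J) where
  add t a b := by
    obtain ⟨a, rfl⟩ := Ideal.Quotient.mk_surjective a
    obtain ⟨b, rfl⟩ := Ideal.Quotient.mk_surjective b
    rw [← map_add, quotientProj_mk hJ, quotientProj_mk hJ, quotientProj_mk hJ]
    split_ifs <;> simp
  mem t a := by
    unfold quotientProj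
    split_ifs with h
    · have := mk_mem_quotientGrading J
        (homogeneousComponent_isHomogeneous t.toNat (Quotient.out a))
      rwa [Int.toNat_of_nonneg h] at this
    · exact zero_mem _
  eq_self t a ha := by
    rcases lt_or_ge t 0 with h | h
    · rw [eq_zero_of_mem_quotientGrading_of_neg h ha, quotientProj, if_neg (not_le.2 h)]
    · lift t to ℕ using h
      obtain ⟨f, hf, rfl⟩ := exists_of_mem_quotientGrading ha
      rw [quotientProj_mk hJ, if_pos (Int.natCast_nonneg t), Int.toNat_natCast,
        homogeneousComponent_eq_self hf]
  smul t k f a hf := by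
    obtain ⟨a, rfl⟩ := Ideal.Quotient.mk_surjective a
    rw [← Ideal.Quotient.mk_eq_mk, ← Submodule.Quotient.mk_smul, Ideal.Quotient.mk_eq_mk,
      Ideal.Quotient.mk_eq_mk, quotientProj_mk hJ, quotientProj_mk hJ, smul_eq_mul]
    rcases lt_or_ge t 0 with h | h
    · rw [if_neg (not_le.2 h), smul_zero]
      split_ifs with h'
      · rw [homogeneousComponent_mul_of_lt hf _ (by omega), map_zero]
      · rfl
    · lift t to ℕ using h
      rw [if_pos (by omega), if_pos (by omega), Int.toNat_natCast, ← Nat.cast_add,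
        Int.toNat_natCast, homogeneousComponent_mul_of_isHomogeneous hf]
      rfl

/-- Multiplication by `x` on `R ⧸ J` has a kernel killed by a power of `R_+`. -/
def IsFilterRegular (J : Ideal (MvPolynomial (Fin n) R₀)) (x : MvPolynomial (Fin n) R₀) : Prop :=
  ∀ f, x * f ∈ J → ∀ j, ∃ k : ℕ, X j ^ k * f ∈ J

/-- `H^i_{R_+}(R ⧸ J)_t = 0` for `i ≤ e` and `t + i > r`. -/
def VanishesAbove (J : Ideal (MvPolynomial (Fin n) R₀)) (e : ℕ) (r : ℤ) : Prop :=
  ∀ i ≤ e, ∀ t : ℤ, r < t + i → localCohomologyDeg n R₀ (quotientGrading J) i t = ⊥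

theorem VanishesAbove.mem {e : ℕ} {r : ℤ} (h : VanishesAbove J e r) {f : MvPolynomial (Fin n) R₀}
    {k : ℕ} (hf : f.IsHomogeneous k) (hk : r < k) (htors : ∀ j, ∃ l : ℕ, X j ^ l * f ∈ J) :
    f ∈ J := by
  rw [← Ideal.Quotient.eq_zero_iff_mem]
  refine eq_zero_of_localCohomologyDeg_zero (h 0 (Nat.zero_le _) k (by simpa using hk))
    (mk_mem_quotientGrading J hf) fun j => ?_
  obtain ⟨l, hl⟩ := htors j
  exact ⟨l, Ideal.Quotient.eq_zero_iff_mem.2 hl⟩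

theorem isHomogeneous_sup_span (hJ : J.IsHomogeneous (homogeneousSubmodule (Fin n) R₀))
    {x : MvPolynomial (Fin n) R₀} {k : ℕ} (hx : x.IsHomogeneous k) :
    (J ⊔ Ideal.span {x}).IsHomogeneous (homogeneousSubmodule (Fin n) R₀) := by
  refine hJ.sup (Ideal.homogeneous_span _ _ ?_)
  rintro _ rfl
  exact ⟨k, hx⟩

theorem mem_sup_span_singleton {J : Ideal (MvPolynomial (Fin n) R₀)}
    {x f : MvPolynomial (Fin n) R₀} :
    f ∈ J ⊔ Ideal.span {x} ↔ ∃ g, f - x * g ∈ J := by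
  rw [Submodule.mem_sup]
  constructor
  · rintro ⟨y, hy, z, hz, rfl⟩
    obtain ⟨g, rfl⟩ := Ideal.mem_span_singleton'.1 hz
    exact ⟨g, by convert hy using 1; ring⟩
  · rintro ⟨g, hg⟩
    exact ⟨_, hg, x * g, Ideal.mem_span_singleton.2 ⟨g, rfl⟩, by ring⟩

/-- The exact sequence involves the positions `(i, t)` and `(i + 1, t - 1)`, which have the same
sum; hence the bound `r` is kept while one cohomological index is lost. -/
theorem VanishesAbove.sup_span [Nontrivial R₀]
    (hJ : J.IsHomogeneous (homogeneousSubmodule (Fin n) R₀)) {x : MvPolynomial (Fin n) R₀}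
    (hx : x.IsHomogeneous 1) (hreg : IsFilterRegular J x) {e : ℕ} {r : ℤ}
    (h : VanishesAbove J (e + 1) r) : VanishesAbove (J ⊔ Ideal.span {x}) e r := by
  intro i hi t ht
  refine localCohomologyDeg_quotient_eq_bot (isGradedProj_quotientProj hJ) hx
    (Submodule.mapQ J (J ⊔ Ideal.span {x}) LinearMap.id le_sup_left) ?_ ?_ ?_
    (h i (by omega) t ht) (h (i + 1) (by omega) (t - 1) (by push_cast; linarith))
  · intro t y hy
    rcases lt_or_ge t 0 with h | h
    · exact ⟨0, zero_mem _, by rw [map_zero, eq_zero_of_mem_quotientGrading_of_neg h hy]⟩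
    · lift t to ℕ using h
      obtain ⟨f, hf, rfl⟩ := exists_of_mem_quotientGrading hy
      exact ⟨_, mk_mem_quotientGrading J hf, rfl⟩
  · intro m
    obtain ⟨f, rfl⟩ := Ideal.Quotient.mk_surjective m
    have h1 : Submodule.mapQ J (J ⊔ Ideal.span {x}) LinearMap.id le_sup_left
        (Ideal.Quotient.mk J f) = Ideal.Quotient.mk (J ⊔ Ideal.span {x}) f := rfl
    rw [h1, Ideal.Quotient.eq_zero_iff_mem, mem_sup_span_singleton]
    constructor
    · rintro ⟨g, hg⟩
      exact ⟨Ideal.Quotient.mk J g, ((Ideal.Quotient.eq).2 hg).symm⟩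
    · rintro ⟨m', hm'⟩
      obtain ⟨g, rfl⟩ := Ideal.Quotient.mk_surjective m'
      exact ⟨g, (Ideal.Quotient.eq).1 hm'.symm⟩
  · intro m hm j
    obtain ⟨f, rfl⟩ := Ideal.Quotient.mk_surjective m
    obtain ⟨k, hk⟩ := hreg f (Ideal.Quotient.eq_zero_iff_mem.1 hm) j
    exact ⟨k, Ideal.Quotient.eq_zero_iff_mem.2 hk⟩

end QuotientGrading

/-! ### Existence of filter-regular linear forms -/

section FilterRegular

variable {n : ℕ} {R₀ : Type*} [CommRing R₀]

theorem sub_C_constantCoeff_mem {σ : Type*} {P : Ideal (MvPolynomial σ R₀)}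
    (hX : ∀ j, X j ∈ P) (f : MvPolynomial σ R₀) : f - C (constantCoeff f) ∈ P := by
  induction f using MvPolynomial.induction_on with
  | C a => simp
  | add p q hp hq =>
    convert P.add_mem hp hq using 1
    rw [map_add, C_add]; ring
  | mul_X p i _ => simpa using P.mul_mem_left _ (hX i)

/-- The linear form with coefficients `a`. -/
def linForm (a : Fin n → R₀) : MvPolynomial (Fin n) R₀ := ∑ j, C (a j) * X j

theorem isHomogeneous_linForm (a : Fin n → R₀) : (linForm a).IsHomogeneous 1 :=
  IsHomogeneous.sum _ _ _ fun _ _ => isHomogeneous_C_mul_X _ _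

variable [IsArtinianRing R₀] [IsLocalRing R₀]

theorem C_mem_of_mem_maximalIdeal {σ : Type*} (P : Ideal (MvPolynomial σ R₀)) [hP : P.IsPrime]
    {a : R₀} (ha : a ∈ IsLocalRing.maximalIdeal R₀) : C a ∈ P := by
  obtain ⟨k, hk⟩ := (Ring.KrullDimLE.isNilpotent_iff_mem_maximalIdeal).2 ha
  exact hP.mem_of_pow_mem k (by rw [← C_pow, hk, C_0]; exact P.zero_mem)

/-- The maximal ideal of `R₀` is nilpotent, hence contained in every prime; so there is only one
prime containing `R_+`, and it is maximal. -/
theorem eq_of_le_of_X_mem {σ : Type*} {P Q : Ideal (MvPolynomial σ R₀)} [P.IsPrime]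
    [hQ : Q.IsPrime] (hX : ∀ j, X j ∈ P) (hPQ : P ≤ Q) : P = Q := by
  refine le_antisymm hPQ fun f hf => ?_
  have h1 := sub_C_constantCoeff_mem hX f
  have h2 : C (constantCoeff f) ∈ Q := by
    have := Q.sub_mem hf (hPQ h1)
    rwa [sub_sub_cancel] at this
  have h3 : constantCoeff f ∈ IsLocalRing.maximalIdeal R₀ := by
    rw [IsLocalRing.mem_maximalIdeal]
    intro hu
    exact hQ.ne_top (Ideal.eq_top_of_isUnit_mem _ h2 (hu.map C))
  have := P.add_mem h1 (C_mem_of_mem_maximalIdeal P h3)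
  rwa [sub_add_cancel] at this

theorem linForm_mem_of_residue_eq (P : Ideal (MvPolynomial (Fin n) R₀)) [P.IsPrime]
    {a b : Fin n → R₀}
    (hab : ∀ j, IsLocalRing.residue R₀ (a j) = IsLocalRing.residue R₀ (b j))
    (ha : linForm a ∈ P) : linForm b ∈ P := by
  have : linForm a - linForm b ∈ P := by
    rw [linForm, linForm, ← Finset.sum_sub_distrib]
    refine sum_mem fun j _ => ?_
    rw [← sub_mul, ← C_sub]
    exact P.mul_mem_right _ (C_mem_of_mem_maximalIdeal P (Ideal.Quotient.eq.1 (hab j)))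
  have := P.sub_mem ha this
  rwa [sub_sub_cancel] at this

/-- A vector space over an infinite field is not a finite union of proper subspaces. Membership of a
linear form in a prime depends only on the residues of its coefficients, so each prime defines a
subspace of `K^n`. -/
theorem exists_linForm_avoiding [Infinite (IsLocalRing.ResidueField R₀)]
    {Q : Set (Ideal (MvPolynomial (Fin n) R₀))} (hfin : Q.Finite) (hprime : ∀ P ∈ Q, P.IsPrime) :
    ∃ a : Fin n → R₀, ∀ P ∈ Q, linForm a ∈ P → ∀ j, X j ∈ P := by
  classical
  let K := IsLocalRing.ResidueField R₀
  have hsurj := IsLocalRing.residue_surjective (R := R₀)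
  let W : ∀ P : Q, Submodule K (Fin n → K) := fun P =>
    { carrier := {v | ∃ a : Fin n → R₀, (∀ j, IsLocalRing.residue R₀ (a j) = v j) ∧
        linForm a ∈ P.1}
      zero_mem' := ⟨0, by simp, by simp [linForm]⟩
      add_mem' := by
        rintro v w ⟨a, hav, ha⟩ ⟨b, hbw, hb⟩
        refine ⟨a + b, fun j => by simp [hav, hbw], ?_⟩
        convert P.1.add_mem ha hb using 1
        simp [linForm, add_mul, Finset.sum_add_distrib]
      smul_mem' := by
        rintro c v ⟨a, hav, ha⟩
        obtain ⟨c, rfl⟩ := hsurj c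
        refine ⟨c • a, fun j => by simp [hav], ?_⟩
        convert P.1.mul_mem_left (C c) ha using 1
        simp [linForm, Finset.mul_sum, mul_assoc] }
  -- Only proper subspaces are to be avoided; if `W P` is everything, then `P` contains all the
  -- variables.
  let s : Finset (Submodule K (Fin n → K)) :=
    ((hfin.toFinset.attach.image fun P => W ⟨P.1, hfin.mem_toFinset.1 P.2⟩)).erase ⊤
  have hs := Subspace.biUnion_ne_univ_of_top_notMem (s := s) (Finset.notMem_erase _ _)
  obtain ⟨v, hv⟩ := (Set.ne_univ_iff_exists_notMem _).1 hs
  choose a ha using fun j => hsurj (v j)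
  refine ⟨a, fun P hP haP j => ?_⟩
  have := hprime P hP
  have hvW : v ∈ W ⟨P, hP⟩ := ⟨a, ha, haP⟩
  have htop : W ⟨P, hP⟩ = ⊤ := by
    by_contra hne
    apply hv
    simp only [Set.mem_iUnion]
    exact ⟨_, Finset.mem_erase.2 ⟨hne, Finset.mem_image.2
      ⟨⟨P, hfin.mem_toFinset.2 hP⟩, Finset.mem_attach _ _, rfl⟩⟩, hvW⟩
  obtain ⟨b, hb, hbP⟩ : Pi.single j (1 : K) ∈ W ⟨P, hP⟩ := htop ▸ Submodule.mem_top
  have := linForm_mem_of_residue_eq P (b := Pi.single j 1) (fun i => by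
    rw [hb i]; by_cases h : i = j
    · subst h; simp
    · simp [h]) hbP
  simpa [linForm, Pi.single_apply] using this

/-- Over an infinite residue field there is a filter-regular linear form which moreover lies in
no minimal prime of `J` except those containing `R_+`. -/
theorem exists_isFilterRegular [Infinite (IsLocalRing.ResidueField R₀)]
    (J : Ideal (MvPolynomial (Fin n) R₀)) : ∃ x : MvPolynomial (Fin n) R₀,
      x ∈ Set.range (linForm (R₀ := R₀) (n := n)) ∧ IsFilterRegular J x ∧
        ∀ P ∈ J.minimalPrimes, x ∈ P → ∀ j, X j ∈ P := by
  obtain ⟨a, ha⟩ := exists_linForm_avoiding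
    (associatedPrimes.finite (MvPolynomial (Fin n) R₀) (MvPolynomial (Fin n) R₀ ⧸ J))
    (fun P hP => IsAssociatedPrime.isPrime hP)
  refine ⟨linForm a, ⟨a, rfl⟩, ?_, fun P hP => ha P ?_⟩
  · intro f hf j
    let T := LinearMap.ker (LinearMap.lsmul (MvPolynomial (Fin n) R₀)
      (MvPolynomial (Fin n) R₀ ⧸ J) (linForm a))
    -- The minimal primes of the annihilator of the kernel `T` of `x` are associated to `R ⧸ J` and
    -- contain `x`, hence contain every variable.
    have hmem : X j ∈ (Module.annihilator (MvPolynomial (Fin n) R₀) T).radical := by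
      rw [← Ideal.sInf_minimalPrimes, Ideal.mem_sInf]
      intro P hP
      refine ha P (associatedPrimes.subset_of_injective (Submodule.injective_subtype T)
        (Module.associatedPrimes.minimalPrimes_annihilator_subset_associatedPrimes _ _ hP)) ?_ j
      refine hP.1.2 ?_
      rw [Module.mem_annihilator]
      rintro ⟨m, hm⟩
      exact Subtype.ext hm
    obtain ⟨k, hk⟩ := hmem
    refine ⟨k, ?_⟩
    rw [Module.mem_annihilator] at hk
    have := congrArg Subtype.val (hk ⟨Ideal.Quotient.mk J f, Ideal.Quotient.eq_zero_iff_mem.2 hf⟩)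
    exact Ideal.Quotient.eq_zero_iff_mem.1 this
  · apply Module.associatedPrimes.minimalPrimes_annihilator_subset_associatedPrimes
    rwa [Ideal.annihilator_quotient]

end FilterRegular

/-! ### Saturation and Krull dimension of the sections -/

section Dimension

variable {n : ℕ} {R₀ : Type*} [CommRing R₀] {J : Ideal (MvPolynomial (Fin n) R₀)}

/-- Homogeneous elements of large degree in the saturation of `J` lie in `J`. -/
theorem exists_degree_bound [IsNoetherianRing R₀]
    (hJ : J.IsHomogeneous (homogeneousSubmodule (Fin n) R₀)) :
    ∃ r : ℕ, ∀ (k : ℕ) (f : MvPolynomial (Fin n) R₀), f.IsHomogeneous k → r < k →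
      (∀ j, ∃ l : ℕ, X j ^ l * f ∈ J) → f ∈ J := by
  let T : Ideal (MvPolynomial (Fin n) R₀) :=
    { carrier := {f | ∀ j, ∃ l : ℕ, X j ^ l * f ∈ J}
      zero_mem' := fun j => ⟨0, by simp⟩
      add_mem' := by
        intro f g hf hg j
        obtain ⟨a, ha⟩ := hf j
        obtain ⟨b, hb⟩ := hg j
        refine ⟨a + b, ?_⟩
        convert J.add_mem (J.mul_mem_left (X j ^ b) ha) (J.mul_mem_left (X j ^ a) hb) using 1
        ring
      smul_mem' := by
        intro c f hf j
        obtain ⟨a, ha⟩ := hf j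
        refine ⟨a, ?_⟩
        convert J.mul_mem_left c ha using 1
        rw [smul_eq_mul]; ring }
  obtain ⟨G, hG⟩ := (isNoetherianRing_iff_ideal_fg _).1
    (inferInstance : IsNoetherianRing (MvPolynomial (Fin n) R₀)) T
  have hGT : ∀ g ∈ G, ∀ j, ∃ l : ℕ, X j ^ l * g ∈ J := fun g hg =>
    show g ∈ T from hG ▸ Ideal.subset_span hg
  choose! l hl using hGT
  -- One exponent `N` works for all generators of the saturation and all variables. A monomial of
  -- degree above `n * N` is divisible by some `X j ^ N`; the others reach degree at most `n * N +
  -- D` after multiplication by a generator.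
  let N : ℕ := G.sup fun g => Finset.univ.sup fun j => l g j
  have hN : ∀ g ∈ G, ∀ j, X j ^ N * g ∈ J := fun g hg j => by
    have : l g j ≤ N := (Finset.le_sup (f := fun j => l g j) (Finset.mem_univ j)).trans
      (Finset.le_sup (f := fun g => Finset.univ.sup fun j => l g j) hg)
    obtain ⟨m, hm⟩ := Nat.exists_eq_add_of_le this
    rw [hm, pow_add, mul_right_comm]
    exact J.mul_mem_right _ (hl g hg j)
  let D : ℕ := G.sup totalDegree
  have key : ∀ g ∈ G, ∀ a : MvPolynomial (Fin n) R₀, ∀ t, n * N + D < t →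
      homogeneousComponent t (a * g) ∈ J := by
    intro g hg a t ht
    induction a using MvPolynomial.induction_on' with
    | monomial e c =>
      by_cases he : e.degree ≤ n * N
      · rw [homogeneousComponent_eq_zero]
        · exact J.zero_mem
        · have h1 := totalDegree_mul (monomial e c) g
          have h2 := totalDegree_monomial_le e c
          have h3 : g.totalDegree ≤ D := Finset.le_sup hg
          have h4 : (e.sum fun _ => id) = e.degree := rfl
          omega
      · refine homogeneousComponent_mem_of_mem hJ ?_ t
        obtain ⟨j, hj⟩ : ∃ j, N ≤ e j := by
          by_contra! h
          apply he
          rw [Finsupp.degree_eq_sum]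
          calc ∑ i, e i ≤ ∑ _i : Fin n, N := Finset.sum_le_sum fun i _ => (h i).le
            _ = n * N := by simp
        have : monomial e c = monomial (e - Finsupp.single j N) c * X j ^ N := by
          rw [X_pow_eq_monomial, monomial_mul, mul_one, tsub_add_cancel_of_le]
          simpa using hj
        rw [this, mul_assoc]
        exact J.mul_mem_left _ (hN g hg j)
    | add p q hp hq =>
      rw [add_mul, map_add]
      exact J.add_mem hp hq
  refine ⟨n * N + D, fun k f hf hk hT => ?_⟩
  have hfT : f ∈ Ideal.span (G : Set (MvPolynomial (Fin n) R₀)) := hG ▸ hT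
  obtain ⟨a, -, ha⟩ := Submodule.mem_span_finset.1 hfT
  rw [← homogeneousComponent_eq_self hf, ← ha, map_sum]
  exact sum_mem fun g hg => key g hg _ k hk

/-- If `R ⧸ (I + (x_1, …, x_k))` is zero in large degrees, then `dim R ⧸ I ≤ k`. -/
theorem ringKrullDim_quotient_le_of_forall_mem [IsArtinianRing R₀] [Nontrivial R₀]
    (hJ : J.IsHomogeneous (homogeneousSubmodule (Fin n) R₀)) {k T : ℕ}
    {x : Fin k → MvPolynomial (Fin n) R₀} (hx : ∀ i, (x i).IsHomogeneous 1)
    (hT : ∀ t, T < t → ∀ f : MvPolynomial (Fin n) R₀, f.IsHomogeneous t →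
      f ∈ J ⊔ Ideal.span (Set.range x)) :
    ringKrullDim (MvPolynomial (Fin n) R₀ ⧸ J) ≤ k := by
  -- `R ⧸ J` becomes a module over a polynomial ring in `k` variables acting through the `x i`. The
  -- monomials of degree at most `T` generate it, by induction on the degree, so the extension is
  -- integral and its dimension is at most `k`.
  let φ : MvPolynomial (Fin k) R₀ →+* MvPolynomial (Fin n) R₀ ⧸ J :=
    (Ideal.Quotient.mk J).comp (aeval x).toRingHom
  let _ : Algebra (MvPolynomial (Fin k) R₀) (MvPolynomial (Fin n) R₀ ⧸ J) := φ.toAlgebra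
  have hsmul : ∀ (s : MvPolynomial (Fin k) R₀) (f : MvPolynomial (Fin n) R₀),
      s • Ideal.Quotient.mk J f = Ideal.Quotient.mk J (aeval x s * f) := fun s f => by
    rw [Algebra.smul_def, map_mul]; rfl
  let E : Set (Fin n →₀ ℕ) := {e | e.degree ≤ T}
  have hE : E.Finite := Finsupp.finite_of_degree_le T
  let W := Submodule.span (MvPolynomial (Fin k) R₀)
    ((fun e => Ideal.Quotient.mk J (monomial e (1 : R₀))) '' E)
  have hsmall : ∀ t ≤ T, ∀ f : MvPolynomial (Fin n) R₀, f.IsHomogeneous t →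
      Ideal.Quotient.mk J f ∈ W := by
    intro t ht f hf
    rw [f.as_sum, map_sum]
    refine sum_mem fun e he => ?_
    have h1 : monomial e (coeff e f) = aeval x (C (coeff e f)) * monomial e 1 := by
      rw [aeval_C, algebraMap_eq, C_mul_monomial, mul_one]
    rw [h1, ← hsmul]
    refine W.smul_mem _ (Submodule.subset_span ⟨e, ?_, rfl⟩)
    have : e.degree = t := by
      by_contra hne
      exact mem_support_iff.1 he (hf.coeff_eq_zero hne)
    exact this.trans_le ht
  have hW : ∀ t, ∀ f : MvPolynomial (Fin n) R₀, f.IsHomogeneous t →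
      Ideal.Quotient.mk J f ∈ W := by
    intro t
    induction t with
    | zero => exact hsmall 0 (Nat.zero_le _)
    | succ t ih =>
      intro f hf
      by_cases htT : T < t + 1
      · obtain ⟨i, hi, y, hy, hiy⟩ := Submodule.mem_sup.1 (hT _ htT f hf)
        obtain ⟨g, rfl⟩ := Ideal.mem_span_range_iff_exists_fun.1 hy
        have h1 : Ideal.Quotient.mk J f =
            ∑ l, (X l : MvPolynomial (Fin k) R₀) •
              Ideal.Quotient.mk J (homogeneousComponent t (g l)) := by
          rw [← homogeneousComponent_eq_self hf, ← hiy, map_add, map_add,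
            Ideal.Quotient.eq_zero_iff_mem.2 (homogeneousComponent_mem_of_mem hJ hi _), zero_add,
            map_sum, map_sum]
          refine Finset.sum_congr rfl fun l _ => ?_
          rw [hsmul, aeval_X, mul_comm, homogeneousComponent_mul_of_isHomogeneous (hx l)]
        rw [h1]
        exact sum_mem fun l _ => W.smul_mem _ (ih _ (homogeneousComponent_isHomogeneous _ _))
      · exact hsmall _ (not_lt.1 htT) f hf
  have htop : W = ⊤ := by
    rw [eq_top_iff]
    rintro m -
    obtain ⟨f, rfl⟩ := Ideal.Quotient.mk_surjective m
    rw [← sum_homogeneousComponent f, map_sum]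
    exact sum_mem fun i _ => hW i _ (homogeneousComponent_isHomogeneous _ _)
  have : Module.Finite (MvPolynomial (Fin k) R₀) (MvPolynomial (Fin n) R₀ ⧸ J) :=
    ⟨htop ▸ Submodule.fg_span (hE.image _)⟩
  calc ringKrullDim (MvPolynomial (Fin n) R₀ ⧸ J)
      ≤ ringKrullDim (MvPolynomial (Fin k) R₀) :=
        Order.krullDim_le_of_strictMono
          (PrimeSpectrum.comap (algebraMap (MvPolynomial (Fin k) R₀)
            (MvPolynomial (Fin n) R₀ ⧸ J))) fun P Q hPQ =>
              Ideal.IsIntegral.comap_lt_comap (I := P.asIdeal) (J := Q.asIdeal) hPQ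
    _ = k := by
      rw [MvPolynomial.ringKrullDim_of_isNoetherianRing,
        ringKrullDimZero_iff_ringKrullDim_eq_zero.1 inferInstance]
      simp

section Local

variable [IsLocalRing R₀]

/-- A minimal prime of a homogeneous ideal equals its homogeneous core, so it lies in the ideal `Q`
generated by `R_+` and the maximal ideal of `R₀`; dimension zero forces equality. -/
theorem exists_X_pow_mem_of_ringKrullDim_le_zero
    (hJ : J.IsHomogeneous (homogeneousSubmodule (Fin n) R₀))
    (h : ringKrullDim (MvPolynomial (Fin n) R₀ ⧸ J) ≤ 0) (j : Fin n) :
    ∃ k : ℕ, X j ^ k ∈ J := by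
  suffices X j ∈ J.radical from this
  rw [← Ideal.sInf_minimalPrimes, Ideal.mem_sInf]
  intro P hP
  have hPprime : P.IsPrime := hP.1.1
  have hcore : J ≤ (P.homogeneousCore (homogeneousSubmodule (Fin n) R₀)).toIdeal := by
    rw [← hJ.toIdeal_homogeneousCore_eq_self]
    exact Ideal.homogeneousCore_mono _ hP.1.2
  have hPhom : P.IsHomogeneous (homogeneousSubmodule (Fin n) R₀) := by
    have := hP.2 ⟨hPprime.homogeneousCore, hcore⟩ (Ideal.toIdeal_homogeneousCore_le _ P)
    rw [Ideal.IsHomogeneous.iff_eq]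
    exact le_antisymm (Ideal.toIdeal_homogeneousCore_le _ P) this
  let Q : Ideal (MvPolynomial (Fin n) R₀) :=
    RingHom.ker ((IsLocalRing.residue R₀).comp constantCoeff)
  have hQ : Q.IsPrime := RingHom.ker_isPrime _
  have hPQ : P ≤ Q := by
    intro f hf
    have h0 := homogeneousComponent_mem_of_mem hPhom hf 0
    rw [homogeneousComponent_zero] at h0
    rw [RingHom.mem_ker, RingHom.comp_apply, IsLocalRing.residue_eq_zero_iff,
      IsLocalRing.mem_maximalIdeal]
    intro hu
    exact hPprime.ne_top (Ideal.eq_top_of_isUnit_mem _ h0 (hu.map C))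
  have hXQ : X j ∈ Q := by simp [Q, RingHom.mem_ker]
  rcases hPQ.eq_or_lt with h' | hlt
  · rwa [h']
  · exfalso
    rw [ringKrullDim_quotient] at h
    let a : PrimeSpectrum.zeroLocus (J : Set (MvPolynomial (Fin n) R₀)) :=
      ⟨⟨P, hPprime⟩, hP.1.2⟩
    let b : PrimeSpectrum.zeroLocus (J : Set (MvPolynomial (Fin n) R₀)) :=
      ⟨⟨Q, hQ⟩, hP.1.2.trans hPQ⟩
    have hab : a < b := hlt
    let l : LTSeries (PrimeSpectrum.zeroLocus (J : Set (MvPolynomial (Fin n) R₀))) :=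
      (RelSeries.singleton _ b).cons a hab
    have hl := (Order.LTSeries.length_le_krullDim l).trans h
    have h2 : l.length = 1 := RelSeries.cons_length _ _ _
    rw [h2] at hl
    exact absurd hl (by norm_num)

variable [IsArtinianRing R₀]

/-- Take a minimal prime `P` of `J` below a chain of primes containing `J` and `x`. If `x ∉ P`, then
`P` lengthens the chain; if `x ∈ P`, then `P` contains `R_+`, so it is maximal and the chain has
length zero. -/
theorem ringKrullDim_quotient_sup_span_le {x : MvPolynomial (Fin n) R₀}
    (hx : ∀ P ∈ J.minimalPrimes, x ∈ P → ∀ j, X j ∈ P) {e : ℕ}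
    (he : ringKrullDim (MvPolynomial (Fin n) R₀ ⧸ J) ≤ (e + 1 : ℕ)) :
    ringKrullDim (MvPolynomial (Fin n) R₀ ⧸ (J ⊔ Ideal.span {x})) ≤ e := by
  rw [ringKrullDim_quotient] at he ⊢
  refine iSup_le fun l => ?_
  have hJx : J ≤ l.head.1.asIdeal := le_sup_left.trans l.head.2
  obtain ⟨P, hP, hPl⟩ := Ideal.exists_minimalPrimes_le hJx
  have hPprime : P.IsPrime := hP.1.1
  by_cases hxP : x ∈ P
  · have h0 : l.length = 0 := by
      by_contra hne
      have hlt : l.head < l.last :=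
        l.strictMono (Fin.lt_def.2 (Nat.pos_of_ne_zero hne))
      have h1 : P = l.head.1.asIdeal := eq_of_le_of_X_mem (hx P hP hxP) hPl
      have h2 : P = l.last.1.asIdeal :=
        eq_of_le_of_X_mem (hx P hP hxP) (hPl.trans hlt.le)
      exact hlt.ne (Subtype.ext (PrimeSpectrum.ext (h1.symm.trans h2)))
    rw [h0]
    exact_mod_cast Nat.zero_le e
  · have hlt : (⟨P, hPprime⟩ : PrimeSpectrum (MvPolynomial (Fin n) R₀)) < l.head.1 := by
      refine lt_of_le_of_ne hPl fun h => hxP ?_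
      have : P = l.head.1.asIdeal := congrArg PrimeSpectrum.asIdeal h
      rw [this]
      exact l.head.2 (Ideal.mem_sup_right (Ideal.mem_span_singleton_self x))
    let f : PrimeSpectrum.zeroLocus ((J ⊔ Ideal.span {x} : Ideal _) : Set _) →
        PrimeSpectrum.zeroLocus (J : Set (MvPolynomial (Fin n) R₀)) :=
      fun Q => ⟨Q.1, show J ≤ Q.1.asIdeal from le_sup_left.trans Q.2⟩
    let a : PrimeSpectrum.zeroLocus (J : Set (MvPolynomial (Fin n) R₀)) :=
      ⟨⟨P, hPprime⟩, hP.1.2⟩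
    let l' : LTSeries (PrimeSpectrum.zeroLocus (J : Set (MvPolynomial (Fin n) R₀))) :=
      (l.map f (fun _ _ h => h)).cons a (show a < f l.head from hlt)
    have hl' := (Order.LTSeries.length_le_krullDim l').trans he
    have h2 : l'.length = l.length + 1 := RelSeries.cons_length _ _ _
    rw [h2] at hl'
    have : l.length + 1 ≤ e + 1 := by exact_mod_cast hl'
    have : l.length ≤ e := by omega
    exact_mod_cast this

end Local

end Dimension

/-! ### Lengths of graded pieces -/

section Length

variable {n : ℕ} {R₀ : Type*} [CommRing R₀] {J : Ideal (MvPolynomial (Fin n) R₀)}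

instance finite_quotientGrading (J : Ideal (MvPolynomial (Fin n) R₀)) (t : ℤ) :
    Module.Finite R₀ (quotientGrading J t) := by
  rw [Module.Finite.iff_fg, quotientGrading]
  split_ifs
  · exact (homogeneousSubmodule_fg (Fin n) R₀ _).map _
  · exact Submodule.fg_bot

theorem card_degree_eq (m t : ℕ) :
    ENat.card {e : Fin m →₀ ℕ | e.degree = t} = ((m + t - 1).choose t : ℕ) := by
  have h : {e : Fin m →₀ ℕ | e.degree = t} =
      ((Finset.univ : Finset (Fin m)).finsuppAntidiag t : Set (Fin m →₀ ℕ)) := by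
    ext e
    simp [Finsupp.degree_eq_sum]
  rw [h, ENat.card_coe_set_eq, Set.encard_coe_eq_coe_finsetCard,
    Finset.card_finsuppAntidiag_nat_eq_choose, Finset.card_univ, Fintype.card_fin]

theorem length_homogeneousSubmodule (m t : ℕ) :
    Module.length R₀ (homogeneousSubmodule (Fin m) R₀ t) =
      ((m + t - 1).choose t : ℕ) * Module.length R₀ R₀ := by
  rw [homogeneousSubmodule_eq_finsupp_supported]
  rw [← card_degree_eq, ← Module.length_finsupp]
  exact (AddMonoidAlgebra.supportedEquivFinsupp _).length_eq

/-- Modulo `J`, the variables are linear combinations of `m` linear forms. -/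
def IsGeneratedBy (J : Ideal (MvPolynomial (Fin n) R₀)) (m : ℕ) : Prop :=
  ∃ y : Fin m → MvPolynomial (Fin n) R₀,
    ∀ j, ∃ b : Fin m → R₀, X j - ∑ i, C (b i) * y i ∈ J

/-- The projection `R → R ⧸ J` factors through a polynomial ring in `m` variables. The first map `θ`
sends variables to linear forms and so keeps degrees; the second need not be graded. -/
theorem length_quotientGrading_le {m : ℕ} (h : IsGeneratedBy J m) (t : ℕ) :
    Module.length R₀ (quotientGrading J t) ≤
      ((m + t - 1).choose t : ℕ) * Module.length R₀ R₀ := by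
  obtain ⟨y, hb⟩ := h
  choose b hb using hb
  let θ : MvPolynomial (Fin n) R₀ →ₐ[R₀] MvPolynomial (Fin m) R₀ := aeval fun j => linForm (b j)
  let ψ : MvPolynomial (Fin m) R₀ →ₐ[R₀] MvPolynomial (Fin n) R₀ ⧸ J :=
    (Ideal.Quotient.mkₐ R₀ J).comp (aeval y)
  have hcomp : ψ.comp θ = Ideal.Quotient.mkₐ R₀ J := by
    refine MvPolynomial.algHom_ext fun j => ?_
    have h1 : aeval y (linForm (b j)) = ∑ i, C (b j i) * y i := by
      simp [linForm, algebraMap_eq]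
    simp only [AlgHom.comp_apply, θ, ψ, aeval_X, h1]
    exact ((Ideal.Quotient.eq).2 (hb j)).symm
  let g : homogeneousSubmodule (Fin m) R₀ t →ₗ[R₀] MvPolynomial (Fin n) R₀ ⧸ J :=
    ψ.toLinearMap ∘ₗ (homogeneousSubmodule (Fin m) R₀ t).subtype
  have hle : quotientGrading J t ≤ LinearMap.range g := by
    intro m' hm'
    obtain ⟨f, hf, rfl⟩ := exists_of_mem_quotientGrading hm'
    refine ⟨⟨θ f, ?_⟩, DFunLike.congr_fun hcomp f⟩
    have := hf.aeval (fun j => linForm (b j)) fun j => isHomogeneous_linForm (b j)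
    rwa [one_mul] at this
  rw [← length_homogeneousSubmodule]
  exact (Module.length_le_of_injective (Submodule.inclusion hle)
    (Submodule.inclusion_injective hle)).trans
      (Module.length_le_of_surjective g.rangeRestrict g.surjective_rangeRestrict)

theorem hilbertFunction_le [IsArtinianRing R₀] {m : ℕ} (h : IsGeneratedBy J m) (t : ℕ) :
    hilbertFunction (quotientGrading J) t ≤ ringLength R₀ * (m + t - 1).choose t := by
  have h1 := length_quotientGrading_le h t
  have h2 : Module.length R₀ R₀ ≠ ⊤ := Module.length_ne_top
  rw [hilbertFunction, ringLength]
  lift Module.length R₀ R₀ to ℕ using h2 with l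
  rw [← Nat.cast_mul] at h1
  rw [ENat.toNat_natCast, mul_comm]
  exact ENat.toNat_le_of_le_natCast h1

theorem isGeneratedBy_self (J : Ideal (MvPolynomial (Fin n) R₀)) : IsGeneratedBy J n :=
  ⟨X, fun j => ⟨Pi.single j 1, by simp [Pi.single_apply]⟩⟩

/-- Modulo `J` the form is `∑ c_i y_i`. Were all `c_i` in the maximal ideal, the form would lie in
`P`; so some `c_i` is a unit and `y_i` can be eliminated. -/
theorem IsGeneratedBy.sup_span [IsArtinianRing R₀] [IsLocalRing R₀] {m : ℕ}
    (h : IsGeneratedBy J (m + 1)) {P : Ideal (MvPolynomial (Fin n) R₀)} [P.IsPrime] (hJP : J ≤ P)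
    {a : Fin n → R₀} (haP : linForm a ∉ P) : IsGeneratedBy (J ⊔ Ideal.span {linForm a}) m := by
  obtain ⟨y, hb⟩ := h
  choose b hb using hb
  let c : Fin (m + 1) → R₀ := fun i => ∑ j, a j * b j i
  have hc : linForm a - ∑ i, C (c i) * y i ∈ J := by
    have : linForm a - ∑ i, C (c i) * y i = ∑ j, C (a j) * (X j - ∑ i, C (b j i) * y i) := by
      simp only [c, map_sum, Finset.sum_mul, mul_sub, Finset.sum_sub_distrib, Finset.mul_sum,
        C_mul, linForm]
      rw [Finset.sum_comm]
      simp only [mul_assoc]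
    rw [this]
    exact sum_mem fun j _ => J.mul_mem_left _ (hb j)
  obtain ⟨i₀, u, hu⟩ : ∃ i, IsUnit (c i) := by
    by_contra! hne
    apply haP
    have h1 : ∑ i, C (c i) * y i ∈ P := sum_mem fun i _ => P.mul_mem_right _
      (C_mem_of_mem_maximalIdeal P ((IsLocalRing.mem_maximalIdeal _).2 (hne i)))
    have := P.add_mem (hJP hc) h1
    rwa [sub_add_cancel] at this
  refine ⟨fun i => y (i₀.succAbove i), fun j =>
    ⟨fun i => b j (i₀.succAbove i) - b j i₀ * ↑u⁻¹ * c (i₀.succAbove i), ?_⟩⟩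
  have hbj := hb j
  rw [Fin.sum_univ_succAbove _ i₀] at hbj hc
  rw [mem_sup_span_singleton]
  refine ⟨C (b j i₀) * C ((u⁻¹ : R₀ˣ) : R₀), ?_⟩
  have huu : C ((u⁻¹ : R₀ˣ) : R₀) * C (c i₀) = (1 : MvPolynomial (Fin n) R₀) := by
    rw [← C_mul, ← hu, Units.inv_mul, C_1]
  have hsum : ∑ i, C (b j (i₀.succAbove i) - b j i₀ * ↑u⁻¹ * c (i₀.succAbove i)) *
      y (i₀.succAbove i) = ∑ i, C (b j (i₀.succAbove i)) * y (i₀.succAbove i) -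
        C (b j i₀) * C ((u⁻¹ : R₀ˣ) : R₀) * ∑ i, C (c (i₀.succAbove i)) * y (i₀.succAbove i) := by
    rw [Finset.mul_sum, ← Finset.sum_sub_distrib]
    refine Finset.sum_congr rfl fun i _ => ?_
    simp only [C_sub, C_mul]
    ring
  rw [hsum]
  convert J.sub_mem hbj (J.mul_mem_left (C (b j i₀) * C ((u⁻¹ : R₀ˣ) : R₀)) hc) using 1
  linear_combination (-C (b j i₀) * y i₀) * huu

/-- Here `u` is the length of the image of multiplication by `x` from degree `t` to degree `t + 1`,
whose cokernel is the graded piece of the section. -/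
theorem hilbertFunction_sup_span [IsArtinianRing R₀]
    (hJ : J.IsHomogeneous (homogeneousSubmodule (Fin n) R₀))
    {x : MvPolynomial (Fin n) R₀} (hx : x.IsHomogeneous 1) (t : ℕ) :
    ∃ u, hilbertFunction (quotientGrading J) ((t + 1 : ℕ) : ℤ) =
        u + hilbertFunction (quotientGrading (J ⊔ Ideal.span {x})) ((t + 1 : ℕ) : ℤ) ∧
      u ≤ hilbertFunction (quotientGrading J) t ∧
      ((∀ f : MvPolynomial (Fin n) R₀, f.IsHomogeneous t → x * f ∈ J → f ∈ J) →
        u = hilbertFunction (quotientGrading J) t) := by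
  let J' := J ⊔ Ideal.span {x}
  have hα : ∀ m ∈ quotientGrading J t,
      LinearMap.mulLeft R₀ (Ideal.Quotient.mk J x) m ∈ quotientGrading J ((t + 1 : ℕ) : ℤ) := by
    intro m hm
    obtain ⟨f, hf, rfl⟩ := exists_of_mem_quotientGrading hm
    rw [LinearMap.mulLeft_apply, ← map_mul, add_comm]
    exact mk_mem_quotientGrading J (hx.mul hf)
  let α := (LinearMap.mulLeft R₀ (Ideal.Quotient.mk J x)).restrict hα
  have hβ : ∀ m ∈ quotientGrading J ((t + 1 : ℕ) : ℤ),
      (Ideal.Quotient.factorₐ R₀ (le_sup_left : J ≤ J')).toLinearMap m ∈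
        quotientGrading J' ((t + 1 : ℕ) : ℤ) := by
    intro m hm
    obtain ⟨f, hf, rfl⟩ := exists_of_mem_quotientGrading hm
    exact mk_mem_quotientGrading J' hf
  let β := (Ideal.Quotient.factorₐ R₀ (le_sup_left : J ≤ J')).toLinearMap.restrict hβ
  have hβs : Function.Surjective β := by
    rintro ⟨m, hm⟩
    obtain ⟨f, hf, rfl⟩ := exists_of_mem_quotientGrading hm
    exact ⟨⟨_, mk_mem_quotientGrading J hf⟩, Subtype.ext rfl⟩
  have hexact : Function.Exact (LinearMap.range α).subtype β := by
    rintro ⟨m, hm⟩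
    obtain ⟨f, hf, rfl⟩ := exists_of_mem_quotientGrading hm
    have h1 : β ⟨_, hm⟩ = 0 ↔ f ∈ J' := by
      rw [← Ideal.Quotient.eq_zero_iff_mem (I := J')]
      exact Subtype.ext_iff
    rw [h1, mem_sup_span_singleton]
    constructor
    · rintro ⟨g, hg⟩
      refine ⟨⟨⟨_, hm⟩, ⟨⟨_, mk_mem_quotientGrading J
        (homogeneousComponent_isHomogeneous t g)⟩, ?_⟩⟩, rfl⟩
      refine Subtype.ext ?_
      change Ideal.Quotient.mk J x * Ideal.Quotient.mk J _ = _
      rw [← map_mul, eq_comm, Ideal.Quotient.eq, ← homogeneousComponent_mul_of_isHomogeneous hx]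
      have := homogeneousComponent_mem_of_mem hJ hg (t + 1)
      rwa [map_sub, homogeneousComponent_eq_self hf] at this
    · rintro ⟨⟨_, ⟨⟨m', hm'⟩, rfl⟩⟩, hmm⟩
      obtain ⟨g, hg, rfl⟩ := exists_of_mem_quotientGrading hm'
      refine ⟨g, ?_⟩
      rw [← Ideal.Quotient.eq, map_mul]
      exact (congrArg Subtype.val hmm).symm
  have hlen := Module.length_eq_add_of_exact _ _ (Submodule.injective_subtype _) hβs hexact
  have hne : ∀ (K : Ideal (MvPolynomial (Fin n) R₀)) (s : ℤ),
      Module.length R₀ (quotientGrading K s) ≠ ⊤ := fun K s => Module.length_ne_top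
  have hne' : Module.length R₀ (LinearMap.range α) ≠ ⊤ := Module.length_ne_top
  refine ⟨(Module.length R₀ (LinearMap.range α)).toNat, ?_, ?_, ?_⟩
  · rw [hilbertFunction, hlen, ENat.toNat_add hne' (hne _ _)]; rfl
  · exact ENat.toNat_le_toNat (Module.length_le_of_surjective α.rangeRestrict
      α.surjective_rangeRestrict) (hne _ _)
  · intro hinj
    have : Function.Injective α := by
      rw [← LinearMap.ker_eq_bot, LinearMap.ker_eq_bot']
      rintro ⟨m, hm⟩ h0
      obtain ⟨f, hf, rfl⟩ := exists_of_mem_quotientGrading hm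
      refine Subtype.ext (Ideal.Quotient.eq_zero_iff_mem.2 (hinj f hf ?_))
      rw [← Ideal.Quotient.eq_zero_iff_mem, map_mul]
      exact congrArg Subtype.val h0
    exact congrArg ENat.toNat (LinearEquiv.ofInjective α this).length_eq.symm

end Length

/-! ### Difference equations and bounds on their coefficients -/

section Numeric

/-- The polynomial `binom (t + m) m` in `t`. -/
def binomPoly (m : ℕ) (t : ℤ) : ℤ := Ring.choose (t + m) m

theorem binomPoly_zero (t : ℤ) : binomPoly 0 t = 1 := by simp [binomPoly]

theorem binomPoly_succ (m : ℕ) (t : ℤ) :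
    binomPoly (m + 1) t = binomPoly (m + 1) (t - 1) + binomPoly m t := by
  have := Ring.choose_succ_succ (t + m) m
  simp only [binomPoly]
  rw [show t + ((m + 1 : ℕ) : ℤ) = t + m + 1 by push_cast; ring, this,
    show t - 1 + ((m + 1 : ℕ) : ℤ) = t + m by push_cast; ring, add_comm]

theorem binomPoly_neg_one (m : ℕ) : binomPoly (m + 1) (-1) = 0 := by
  rw [binomPoly, show (-1 : ℤ) + ((m + 1 : ℕ) : ℤ) = (m : ℕ) by push_cast; ring,
    Ring.choose_natCast, Nat.choose_succ_self, Nat.cast_zero]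

theorem binomPoly_natCast (m t : ℕ) : binomPoly m t = ((t + m).choose m : ℕ) := by
  rw [binomPoly, ← Nat.cast_add, Ring.choose_natCast]

/-- The Hilbert polynomial with `D` coefficients `e`. -/
def coeffPoly (e : ℕ → ℤ) (D : ℕ) (t : ℤ) : ℤ :=
  ∑ i ∈ Finset.range D, (-1) ^ i * e i * binomPoly (D - 1 - i) t

theorem coeffPoly_zero (e : ℕ → ℤ) (t : ℤ) : coeffPoly e 0 t = 0 := rfl

theorem coeffPoly_succ (e : ℕ → ℤ) (D : ℕ) (t : ℤ) :
    coeffPoly e (D + 1) t = ∑ i ∈ Finset.range D, (-1) ^ i * e i * binomPoly (D - 1 - i + 1) t +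
      (-1) ^ D * e D := by
  rw [coeffPoly, Finset.sum_range_succ]
  congr 1
  · refine Finset.sum_congr rfl fun i hi => ?_
    have := Finset.mem_range.1 hi
    rw [show D + 1 - 1 - i = D - 1 - i + 1 by omega]
  · rw [show D + 1 - 1 - D = 0 by omega, binomPoly_zero, mul_one]

theorem coeffPoly_sub (e : ℕ → ℤ) (D : ℕ) (t : ℤ) :
    coeffPoly e (D + 1) t = coeffPoly e (D + 1) (t - 1) + coeffPoly e D t := by
  rw [coeffPoly_succ, coeffPoly_succ, coeffPoly, add_right_comm, ← Finset.sum_add_distrib]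
  congr 1
  refine Finset.sum_congr rfl fun i _ => ?_
  rw [binomPoly_succ, mul_add]

theorem coeffPoly_neg_one (e : ℕ → ℤ) (D : ℕ) :
    coeffPoly e (D + 1) (-1) = (-1) ^ D * e D := by
  rw [coeffPoly_succ, Finset.sum_eq_zero, zero_add]
  intro i _
  rw [binomPoly_neg_one, mul_zero]

theorem coeffPoly_congr {e e' : ℕ → ℤ} {D : ℕ} (h : ∀ i < D, e i = e' i) (t : ℤ) :
    coeffPoly e D t = coeffPoly e' D t :=
  Finset.sum_congr rfl fun i hi => by rw [h i (Finset.mem_range.1 hi)]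

theorem exists_coeff {g : ℕ → ℕ → ℤ} {d r : ℕ} (h0 : ∀ t, r < t → g 0 t = 0)
    (hstep : ∀ D < d, ∀ t, r < t → g (D + 1) (t + 1) = g (D + 1) t + g D (t + 1)) :
    ∃ e : ℕ → ℤ, ∀ t, r < t → g d t = coeffPoly e d t := by
  induction d with
  | zero => exact ⟨0, fun t ht => by rw [h0 t ht, coeffPoly_zero]⟩
  | succ d ih =>
    obtain ⟨e, he⟩ := ih fun D hD => hstep D (by omega)
    -- The new coefficient is the constant of summation, fixed by the value at `r + 1`.
    let v : ℤ := (-1) ^ d * (g (d + 1) (r + 1) -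
      ∑ i ∈ Finset.range d, (-1) ^ i * e i * binomPoly (d - 1 - i + 1) ((r + 1 : ℕ) : ℤ))
    let e' := Function.update e d v
    have hee : ∀ i < d, e' i = e i := fun i hi => Function.update_of_ne hi.ne _ _
    refine ⟨e', fun t ht => ?_⟩
    induction t, ht using Nat.le_induction with
    | base =>
      have hs : (-1 : ℤ) ^ d * (-1) ^ d = 1 := by rw [← mul_pow]; simp
      rw [coeffPoly_succ, show e' d = v from Function.update_self _ _ _]
      rw [Finset.sum_congr rfl fun i hi => by rw [hee i (Finset.mem_range.1 hi)]]
      simp only [v]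
      rw [← mul_assoc, hs]
      ring
    | succ t ht ih =>
      rw [hstep d (by omega) t ht, ih, he (t + 1) (by omega), coeffPoly_sub e' d ((t + 1 : ℕ) : ℤ),
        coeffPoly_congr hee]
      push_cast
      rw [add_sub_cancel_right]

/-- Taking differences carries eventual agreement from `d` down to every `D`. Going up from `D = 0`,
the discrepancy is constant for `t > r` and eventually zero. -/
theorem eq_coeffPoly_of_eventually {g : ℕ → ℕ → ℤ} {d r : ℕ} (h0 : ∀ t, r < t → g 0 t = 0)
    (hstep : ∀ D < d, ∀ t, r < t → g (D + 1) (t + 1) = g (D + 1) t + g D (t + 1))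
    {e : ℕ → ℤ} (he : ∀ᶠ t : ℕ in atTop, g d t = coeffPoly e d t) :
    ∀ D ≤ d, ∀ t, r < t → g D t = coeffPoly e D t := by
  have hev : ∀ D ≤ d, ∀ᶠ t : ℕ in atTop, g D t = coeffPoly e D t := by
    intro D hD
    induction hD using Nat.decreasingInduction with
    | self => exact he
    | of_succ D hD ih =>
      obtain ⟨N, hN⟩ := eventually_atTop.1 ih
      refine eventually_atTop.2 ⟨N + r + 2, fun t ht => ?_⟩
      obtain ⟨t, rfl⟩ : ∃ s, t = s + 1 := ⟨t - 1, by omega⟩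
      have h1 := hstep D hD t (by omega)
      have h2 := coeffPoly_sub e D ((t + 1 : ℕ) : ℤ)
      have h3 := hN t (by omega)
      have h4 := hN (t + 1) (by omega)
      rw [show ((t + 1 : ℕ) : ℤ) - 1 = (t : ℤ) by push_cast; ring] at h2
      linarith
  intro D
  induction D with
  | zero => intro _ t ht; rw [h0 t ht, coeffPoly_zero]
  | succ D ih =>
    intro hD t ht
    obtain ⟨N, hN⟩ := eventually_atTop.1 (hev (D + 1) hD)
    have hconst : ∀ s, g (D + 1) (t + s) - coeffPoly e (D + 1) ((t + s : ℕ) : ℤ) =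
        g (D + 1) t - coeffPoly e (D + 1) t := by
      intro s
      induction s with
      | zero => rfl
      | succ s ihs =>
        rw [← ihs]
        have h1 := hstep D (by omega) (t + s) (by omega)
        have h2 := coeffPoly_sub e D ((t + s + 1 : ℕ) : ℤ)
        have h3 := ih (by omega) (t + s + 1) (by omega)
        rw [show ((t + s + 1 : ℕ) : ℤ) - 1 = ((t + s : ℕ) : ℤ) by push_cast; ring] at h2
        rw [← add_assoc]
        linarith
    have h1 := hconst N
    rw [hN (t + N) (by omega), sub_self] at h1
    linarith

theorem choose_succ_add_le (a r : ℕ) : (a + 1 + r).choose r ≤ (r + 1) * (a + r).choose r := by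
  have h := Nat.add_one_mul_choose_eq (a + r) a
  have h1 : (a + r + 1).choose (a + 1) = (a + 1 + r).choose r := by
    rw [show a + r + 1 = a + 1 + r by ring, Nat.choose_symm_add]
  rw [h1, Nat.choose_symm_add] at h
  have h2 : (a + 1) * (a + 1 + r).choose r ≤ (a + 1) * ((r + 1) * (a + r).choose r) := by
    rw [mul_comm (a + 1), ← h, ← mul_assoc]
    exact Nat.mul_le_mul_right _ (by nlinarith)
  exact Nat.le_of_mul_le_mul_left h2 (Nat.succ_pos a)

theorem choose_add_add_le (a D r : ℕ) :
    (a + D + r).choose r ≤ (r + 1) ^ D * (a + r).choose r := by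
  induction D with
  | zero => simp
  | succ D ih =>
    calc (a + (D + 1) + r).choose r ≤ (r + 1) * (a + D + r).choose r :=
          choose_succ_add_le (a + D) r
      _ ≤ (r + 1) * ((r + 1) ^ D * (a + r).choose r) := Nat.mul_le_mul_left _ ih
      _ = _ := by ring

/-- Applying `choose_succ_add_le` twice would give only `2 * (r + 1) ^ 2`; the factor saved here
absorbs the sum `0 + 1 + ⋯ + r` in `iterated_sum_bounds`. -/
theorem two_mul_choose_le (c r : ℕ) :
    2 * (c + 2 + r).choose r ≤ (r + 1) * (r + 2) * (c + r).choose r := by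
  have h := Nat.add_one_mul_choose_eq (c + 1 + r) (c + 1)
  have h1 : (c + 1 + r + 1).choose (c + 1 + 1) = (c + 2 + r).choose r := by
    rw [show c + 1 + r + 1 = c + 2 + r by ring, Nat.choose_symm_add]
  rw [h1, Nat.choose_symm_add] at h
  have h2 : (c + 2) * (2 * (c + 2 + r).choose r) ≤
      (c + 2) * ((r + 1) * (r + 2) * (c + r).choose r) := by
    calc (c + 2) * (2 * (c + 2 + r).choose r)
        = 2 * (c + 2 + r) * (c + 1 + r).choose r := by linarith
      _ ≤ ((r + 2) * (c + 2)) * ((r + 1) * (c + r).choose r) :=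
          Nat.mul_le_mul (by nlinarith) (choose_succ_add_le c r)
      _ = _ := by ring
  exact Nat.le_of_mul_le_mul_left h2 (by omega)

/-- Meant for `q D s = P_D(r - s)`, so that `s = r + 1` is the value at `-1`. Upper and lower bounds
are proved together: each step subtracts the previous level, so an upper bound there yields a lower
bound here and conversely. -/
theorem iterated_sum_bounds {q : ℕ → ℕ → ℤ} {d c r l : ℕ} (hq0 : ∀ s, q 0 s = 0)
    (hstep : ∀ D s, q (D + 1) (s + 1) = q (D + 1) s - q D s)
    (hnonneg : ∀ D < d, 0 ≤ q (D + 1) 0)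
    (hle : ∀ D < d, q (D + 1) 0 ≤ l * (c + D + r).choose r) (D : ℕ) (hD : D < d) :
    ∀ s ≤ r + 1, q (D + 1) s ≤ l * (c + r).choose r * (r + 1) ^ D ∧
      (if D = 0 then 0 else -(l * (c + r).choose r * s * (r + 1) ^ (D - 1) : ℤ)) ≤ q (D + 1) s := by
  set B : ℤ := l * (c + r).choose r with hB
  have hB0 : 0 ≤ B := by positivity
  induction D using Nat.strong_induction_on with
  | _ D ih =>
    match D, ih with
    | 0, _ =>
      have hconst : ∀ s, q 1 s = q 1 0 := by
        intro s
        induction s with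
        | zero => rfl
        | succ s ihs => rw [hstep 0 s, hq0, ihs, sub_zero]
      intro s _
      rw [zero_add, hconst, if_pos rfl]
      exact ⟨by simpa [hB] using hle 0 hD, hnonneg 0 hD⟩
    | D + 1, ih =>
      have hlow : ∀ s ≤ r + 1, -(B * s * (r + 1) ^ D) ≤ q (D + 1 + 1) s := by
        intro s
        induction s with
        | zero => intro _; simpa using hnonneg (D + 1) hD
        | succ s ihs =>
          intro hs
          have h1 := ihs (by omega)
          have h2 := (ih D (by omega) (by omega) s (by omega)).1
          rw [hstep]
          push_cast
          linarith
      have hup : ∀ s ≤ r + 1, q (D + 1 + 1) s ≤ B * (r + 1) ^ (D + 1) := by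
        have htop := hle (D + 1) hD
        match D, ih, htop with
        | 0, ih, htop =>
          have h1 : q 2 0 ≤ B * (r + 1) ^ 1 := by
            refine htop.trans ?_
            have := choose_succ_add_le c r
            have h' : ((c + (0 + 1) + r).choose r : ℤ) ≤ (r + 1) * (c + r).choose r := by
              exact_mod_cast this
            rw [hB, pow_one]
            calc (l : ℤ) * (c + (0 + 1) + r).choose r ≤ l * ((r + 1) * (c + r).choose r) :=
                  mul_le_mul_of_nonneg_left h' (by positivity)
              _ = _ := by ring
          intro s
          induction s with
          | zero => intro _; exact h1
          | succ s ihs =>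
            intro hs
            have h2 := ihs (by omega)
            -- Level one is nonnegative, so level two does not increase with `s`.
            have h3 := (ih 0 (by omega) (by omega) s (by omega)).2
            rw [if_pos rfl] at h3
            rw [hstep]
            linarith
        | D + 1, ih, htop =>
          -- Summing the lower bounds `-(B * s * (r + 1) ^ D)` of the previous level produces `s *
          -- (s - 1) / 2`; doubling avoids the division.
          have hsum : ∀ s ≤ r + 1, 2 * q (D + 1 + 1 + 1) s ≤
              2 * q (D + 1 + 1 + 1) 0 + B * (r + 1) ^ D * (s * (s - 1)) := by
            intro s
            induction s with
            | zero => intro _; simp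
            | succ s ihs =>
              intro hs
              have h2 := ihs (by omega)
              have h3 := (ih (D + 1) (by omega) (by omega) s (by omega)).2
              rw [if_neg (by omega), Nat.add_sub_cancel] at h3
              rw [hstep]
              push_cast
              linarith
          have hC : 2 * ((c + (D + 1 + 1) + r).choose r : ℤ) ≤
              (r + 1) ^ D * ((r + 1) * (r + 2) * (c + r).choose r) := by
            have h1 := choose_add_add_le (c + 2) D r
            have h2 := two_mul_choose_le c r
            have h3 : 2 * (c + (D + 1 + 1) + r).choose r ≤
                (r + 1) ^ D * ((r + 1) * (r + 2) * (c + r).choose r) := by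
              rw [show c + (D + 1 + 1) + r = c + 2 + D + r by ring]
              calc 2 * (c + 2 + D + r).choose r
                  ≤ 2 * ((r + 1) ^ D * (c + 2 + r).choose r) := Nat.mul_le_mul_left _ h1
                _ = (r + 1) ^ D * (2 * (c + 2 + r).choose r) := by ring
                _ ≤ _ := Nat.mul_le_mul_left _ h2
            exact_mod_cast h3
          have hC' := mul_le_mul_of_nonneg_left hC (show (0 : ℤ) ≤ l by positivity)
          intro s hs
          have h4 := hsum s hs
          have h5 : (s : ℤ) * (s - 1) ≤ (r + 1) * r := by
            rcases Nat.eq_zero_or_pos s with h | h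
            · subst h; simp only [Nat.cast_zero, zero_mul]; positivity
            · have h6 : (s : ℤ) ≤ r + 1 := by exact_mod_cast hs
              have h7 : (1 : ℤ) ≤ s := by exact_mod_cast h
              exact mul_le_mul h6 (by linarith) (by linarith) (by positivity)
          have h6 := mul_le_mul_of_nonneg_left h5 (show (0 : ℤ) ≤ B * (r + 1) ^ D by positivity)
          -- The two contributions fit exactly: `(r + 1) * (r + 2) + (r + 1) * r = 2 * (r + 1) ^ 2`.
          have h7 : 2 * q (D + 1 + 1 + 1) s ≤ 2 * (B * (r + 1) ^ (D + 1 + 1)) := by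
            calc 2 * q (D + 1 + 1 + 1) s
                ≤ 2 * q (D + 1 + 1 + 1) 0 + B * (r + 1) ^ D * (s * (s - 1)) := h4
              _ ≤ l * ((r + 1) ^ D * ((r + 1) * (r + 2) * (c + r).choose r)) +
                  B * (r + 1) ^ D * ((r + 1) * r) := by
                refine add_le_add ?_ h6
                linarith
              _ = _ := by rw [hB]; ring
          linarith
      intro s hs
      rw [if_neg (by omega), Nat.add_sub_cancel]
      exact ⟨hup s hs, hlow s hs⟩

/-- The recursion for `g` starts only beyond `r`, so `g (D + 1) r` may differ from the polynomial
value at `r`; `hr` says that this value is the image length `u`, which is what gives both its sign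
and its bound. -/
theorem coeff_bounds {g : ℕ → ℕ → ℕ} {d c r l : ℕ} (h0 : ∀ t, r < t → g 0 t = 0)
    (hstep : ∀ D < d, ∀ t, r < t → g (D + 1) (t + 1) = g (D + 1) t + g D (t + 1))
    (hr : ∀ D < d, ∃ u, g (D + 1) (r + 1) = u + g D (r + 1) ∧ u ≤ g (D + 1) r)
    (hle : ∀ D < d, g (D + 1) r ≤ l * (c + D + r).choose r)
    {e : ℕ → ℤ} (he : ∀ᶠ t : ℕ in atTop, (g d t : ℤ) = coeffPoly e d t) :
    (0 < d → 0 ≤ e 0 ∧ e 0 ≤ l * (c + r).choose r) ∧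
      ∀ D, 1 ≤ D → D < d → |e D| ≤ l * (r + 1) ^ (c + D) := by
  have key := eq_coeffPoly_of_eventually (g := fun D t => (g D t : ℤ)) (d := d) (r := r)
    (fun t ht => by exact_mod_cast h0 t ht) (fun D hD t ht => by exact_mod_cast hstep D hD t ht) he
  have hval : ∀ D < d, ∃ u : ℕ, coeffPoly e (D + 1) r = u ∧ u ≤ g (D + 1) r := by
    intro D hD
    obtain ⟨u, hu, hu'⟩ := hr D hD
    refine ⟨u, ?_, hu'⟩
    have h1 := coeffPoly_sub e D ((r + 1 : ℕ) : ℤ)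
    have h2 := key D (by omega) (r + 1) (by omega)
    have h3 := key (D + 1) (by omega) (r + 1) (by omega)
    rw [show ((r + 1 : ℕ) : ℤ) - 1 = (r : ℤ) by push_cast; ring] at h1
    rw [hu] at h3
    push_cast at h1 h2 h3
    linarith
  have hb := iterated_sum_bounds (q := fun D s => coeffPoly e D (r - s)) (d := d) (c := c)
    (r := r) (l := l) (fun s => coeffPoly_zero _ _) (fun D s => by
      have := coeffPoly_sub e D (r - s)
      push_cast
      rw [show (r : ℤ) - (s + 1) = r - s - 1 by ring]
      linarith)
    (fun D hD => by
      obtain ⟨u, hu, -⟩ := hval D hD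
      simp only [Nat.cast_zero, sub_zero, hu]
      positivity)
    (fun D hD => by
      obtain ⟨u, hu, hu'⟩ := hval D hD
      simp only [Nat.cast_zero, sub_zero, hu]
      exact_mod_cast hu'.trans (hle D hD))
  have hneg : ∀ D, coeffPoly e (D + 1) (r - ((r + 1 : ℕ) : ℤ)) = (-1) ^ D * e D := fun D => by
    rw [show (r : ℤ) - ((r + 1 : ℕ) : ℤ) = -1 by push_cast; ring, coeffPoly_neg_one]
  constructor
  · intro hd
    obtain ⟨h1, h2⟩ := hb 0 hd (r + 1) le_rfl
    simp only [hneg] at h1 h2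
    simpa [and_comm] using And.intro h1 h2
  · intro D hD1 hD
    obtain ⟨h1, h2⟩ := hb D hD (r + 1) le_rfl
    simp only [hneg] at h1 h2
    rw [if_neg (by omega)] at h2
    obtain ⟨D, rfl⟩ : ∃ D', D = D' + 1 := ⟨D - 1, by omega⟩
    have h3 : |e (D + 1)| ≤ l * (c + r).choose r * (r + 1) ^ (D + 1) := by
      have : |e (D + 1)| = |(-1) ^ (D + 1) * e (D + 1)| := by
        rw [abs_mul, abs_pow, abs_neg, abs_one, one_pow, one_mul]
      rw [this, abs_le]
      refine ⟨le_trans (le_of_eq ?_) h2, h1⟩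
      rw [Nat.add_sub_cancel]
      push_cast
      ring
    refine h3.trans ?_
    have h4 := choose_add_add_le 0 c r
    simp only [zero_add, Nat.choose_self, mul_one] at h4
    have h5 : ((c + r).choose r : ℤ) ≤ (r + 1) ^ c := by exact_mod_cast h4
    calc (l : ℤ) * (c + r).choose r * (r + 1) ^ (D + 1) ≤ l * (r + 1) ^ c * (r + 1) ^ (D + 1) := by
          gcongr
      _ = l * (r + 1) ^ (c + (D + 1)) := by ring

end Numeric

/-! ### Successive generic hyperplane sections -/

section HyperplaneSections

variable {n : ℕ} {R₀ : Type*} [CommRing R₀] [IsArtinianRing R₀] [IsLocalRing R₀]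
  [Infinite (IsLocalRing.ResidueField R₀)]

/-- A chosen filter-regular linear form. -/
def nextForm (J : Ideal (MvPolynomial (Fin n) R₀)) : MvPolynomial (Fin n) R₀ :=
  (exists_isFilterRegular J).choose

theorem nextForm_mem_range (J : Ideal (MvPolynomial (Fin n) R₀)) :
    nextForm J ∈ Set.range (linForm (R₀ := R₀) (n := n)) :=
  (exists_isFilterRegular J).choose_spec.1

theorem isFilterRegular_nextForm (J : Ideal (MvPolynomial (Fin n) R₀)) :
    IsFilterRegular J (nextForm J) :=
  (exists_isFilterRegular J).choose_spec.2.1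

theorem X_mem_of_nextForm_mem {J P : Ideal (MvPolynomial (Fin n) R₀)} (hP : P ∈ J.minimalPrimes)
    (h : nextForm J ∈ P) (j : Fin n) : X j ∈ P :=
  (exists_isFilterRegular J).choose_spec.2.2 P hP h j

theorem isHomogeneous_nextForm (J : Ideal (MvPolynomial (Fin n) R₀)) :
    (nextForm J).IsHomogeneous 1 := by
  obtain ⟨a, ha⟩ := nextForm_mem_range J
  rw [← ha]
  exact isHomogeneous_linForm a

/-- `I + (x_1, …, x_k)` for generic linear forms `x_1, …, x_k`. -/
def hyperplaneSection (I : Ideal (MvPolynomial (Fin n) R₀)) : ℕ → Ideal (MvPolynomial (Fin n) R₀)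
  | 0 => I
  | k + 1 => hyperplaneSection I k ⊔ Ideal.span {nextForm (hyperplaneSection I k)}

variable {I : Ideal (MvPolynomial (Fin n) R₀)}

theorem isHomogeneous_hyperplaneSection
    (hI : I.IsHomogeneous (homogeneousSubmodule (Fin n) R₀)) (k : ℕ) :
    (hyperplaneSection I k).IsHomogeneous (homogeneousSubmodule (Fin n) R₀) := by
  induction k with
  | zero => exact hI
  | succ k ih => exact isHomogeneous_sup_span ih (isHomogeneous_nextForm _)

theorem hyperplaneSection_le (I : Ideal (MvPolynomial (Fin n) R₀)) (k : ℕ) :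
    ∃ x : Fin k → MvPolynomial (Fin n) R₀, (∀ i, (x i).IsHomogeneous 1) ∧
      hyperplaneSection I k ≤ I ⊔ Ideal.span (Set.range x) := by
  induction k with
  | zero => exact ⟨Fin.elim0, fun i => i.elim0, le_sup_left⟩
  | succ k ih =>
    obtain ⟨x, hx, hle⟩ := ih
    refine ⟨Fin.cons (nextForm (hyperplaneSection I k)) x, fun i => ?_, ?_⟩
    · refine Fin.cases ?_ (fun i => ?_) i
      · exact isHomogeneous_nextForm _
      · exact hx i
    · rw [Fin.range_cons, Ideal.span_insert]
      exact sup_le (hle.trans (sup_le_sup_left le_sup_right _))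
        (le_sup_left.trans le_sup_right)

theorem ringKrullDim_hyperplaneSection_le {d : ℕ}
    (hdim : ringKrullDim (MvPolynomial (Fin n) R₀ ⧸ I) = d) (k m : ℕ) (hkm : k + m = d) :
    ringKrullDim (MvPolynomial (Fin n) R₀ ⧸ hyperplaneSection I k) ≤ m := by
  induction k generalizing m with
  | zero => rw [← hkm, zero_add] at hdim; exact hdim.le
  | succ k ih =>
    exact ringKrullDim_quotient_sup_span_le (fun P hP h => X_mem_of_nextForm_mem hP h)
      (ih (m + 1) (by omega))

/-- Otherwise every minimal prime contains `R_+`, the section vanishes in large degrees, and `R ⧸ I`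
has dimension at most `k < d`. -/
theorem exists_minimalPrimes_nextForm_notMem
    (hI : I.IsHomogeneous (homogeneousSubmodule (Fin n) R₀)) {d : ℕ}
    (hdim : ringKrullDim (MvPolynomial (Fin n) R₀ ⧸ I) = d) {k : ℕ} (hk : k < d) :
    ∃ P ∈ (hyperplaneSection I k).minimalPrimes, nextForm (hyperplaneSection I k) ∉ P := by
  by_contra! h
  have hnil : ∀ j, ∃ l : ℕ, X j ^ l ∈ hyperplaneSection I k := fun j => by
    suffices X j ∈ (hyperplaneSection I k).radical from this
    rw [← Ideal.sInf_minimalPrimes, Ideal.mem_sInf]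
    exact fun {P} hP => X_mem_of_nextForm_mem hP (h P hP) j
  obtain ⟨r, hr⟩ := exists_degree_bound (isHomogeneous_hyperplaneSection hI k)
  obtain ⟨x, hx, hle⟩ := hyperplaneSection_le I k
  have := ringKrullDim_quotient_le_of_forall_mem hI (T := r) hx fun t ht f hf =>
    hle (hr t f hf ht fun j => by
      obtain ⟨l, hl⟩ := hnil j
      exact ⟨l, Ideal.mul_mem_right _ _ hl⟩)
  rw [hdim] at this
  have : d ≤ k := by exact_mod_cast this
  omega

theorem isGeneratedBy_hyperplaneSection
    (hI : I.IsHomogeneous (homogeneousSubmodule (Fin n) R₀)) {d : ℕ}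
    (hdim : ringKrullDim (MvPolynomial (Fin n) R₀ ⧸ I) = d) {k m : ℕ} (hk : k ≤ d)
    (hkm : k + m = n) : IsGeneratedBy (hyperplaneSection I k) m := by
  induction k generalizing m with
  | zero => rw [zero_add] at hkm; rw [hkm]; exact isGeneratedBy_self _
  | succ k ih =>
    obtain ⟨P, hP, hxP⟩ := exists_minimalPrimes_nextForm_notMem hI hdim hk
    have hPprime : P.IsPrime := hP.1.1
    obtain ⟨a, ha⟩ := nextForm_mem_range (hyperplaneSection I k)
    rw [hyperplaneSection]
    rw [← ha] at hxP ⊢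
    exact (ih (by omega) (by omega)).sup_span hP.1.2 hxP

theorem VanishesAbove.hyperplaneSection
    (hI : I.IsHomogeneous (homogeneousSubmodule (Fin n) R₀)) {d : ℕ} {r : ℤ}
    (h : VanishesAbove I d r) {k m : ℕ} (hkm : k + m = d) :
    VanishesAbove (hyperplaneSection I k) m r := by
  induction k generalizing m with
  | zero => rw [zero_add] at hkm; rwa [hkm]
  | succ k ih =>
    exact (ih (m := m + 1) (by omega)).sup_span (isHomogeneous_hyperplaneSection hI k)
      (isHomogeneous_nextForm _) (isFilterRegular_nextForm _)

theorem X_pow_mem_hyperplaneSection (hI : I.IsHomogeneous (homogeneousSubmodule (Fin n) R₀)) {d : ℕ}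
    (hdim : ringKrullDim (MvPolynomial (Fin n) R₀ ⧸ I) = d) (j : Fin n) :
    ∃ l : ℕ, X j ^ l ∈ hyperplaneSection I d :=
  exists_X_pow_mem_of_ringKrullDim_le_zero (isHomogeneous_hyperplaneSection hI d)
    (by exact_mod_cast ringKrullDim_hyperplaneSection_le hdim d 0 rfl) j

/-- The homogeneous elements of degree greater than `r` in the saturation of `J` lie in `J`. -/
def DegreeBound (J : Ideal (MvPolynomial (Fin n) R₀)) (r : ℤ) : Prop :=
  ∀ (k : ℕ) (f : MvPolynomial (Fin n) R₀), f.IsHomogeneous k → r < k →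
    (∀ j, ∃ l : ℕ, X j ^ l * f ∈ J) → f ∈ J

theorem exists_degreeBound_hyperplaneSection
    (hI : I.IsHomogeneous (homogeneousSubmodule (Fin n) R₀)) (d : ℕ) :
    ∃ r : ℕ, ∀ k ≤ d, DegreeBound (hyperplaneSection I k) r := by
  choose r hr using fun k => exists_degree_bound (isHomogeneous_hyperplaneSection hI k)
  refine ⟨(Finset.range (d + 1)).sup r, fun k hk m f hf hm => hr k m f hf ?_⟩
  have := Finset.le_sup (f := r) (Finset.mem_range.2 (show k < d + 1 by omega))
  have : (Finset.range (d + 1)).sup r < m := by exact_mod_cast hm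
  omega

theorem VanishesAbove.degreeBound (hI : I.IsHomogeneous (homogeneousSubmodule (Fin n) R₀)) {d : ℕ}
    {r : ℤ} (h : VanishesAbove I d r) {k : ℕ} (hk : k ≤ d) :
    DegreeBound (CMReg.hyperplaneSection I k) r :=
  fun _ _ hf hm => (h.hyperplaneSection hI (Nat.add_sub_of_le hk)).mem hf hm

theorem hyperplaneSection_le_ker (hIR : I ≤ RingHom.ker (constantCoeff (R := R₀) (σ := Fin n)))
    (k : ℕ) : hyperplaneSection I k ≤ RingHom.ker (constantCoeff (R := R₀) (σ := Fin n)) := by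
  obtain ⟨x, hx, hle⟩ := hyperplaneSection_le I k
  refine hle.trans (sup_le hIR (Ideal.span_le.2 ?_))
  rintro _ ⟨i, rfl⟩
  exact (hx i).coeff_eq_zero (by simp)

/-- The last section is entirely torsion, so `r < 0` would put `1` in its ideal, although all the
ideals stay inside `R_+`. -/
theorem VanishesAbove.nonneg (hI : I.IsHomogeneous (homogeneousSubmodule (Fin n) R₀))
    (hIR : I ≤ RingHom.ker (constantCoeff (R := R₀) (σ := Fin n))) {d : ℕ}
    (hdim : ringKrullDim (MvPolynomial (Fin n) R₀ ⧸ I) = d) {r : ℤ} (h : VanishesAbove I d r) :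
    0 ≤ r := by
  by_contra! hr
  have h1 := h.degreeBound hI le_rfl 0 1 (isHomogeneous_one _ _) (by simpa using hr) fun j => by
    simpa using X_pow_mem_hyperplaneSection hI hdim j
  simpa [RingHom.mem_ker] using hyperplaneSection_le_ker hIR d h1

/-- The Hilbert functions of successive hyperplane sections, starting with the last one. -/
def sectionHilbert (I : Ideal (MvPolynomial (Fin n) R₀)) (d D t : ℕ) : ℕ :=
  hilbertFunction (quotientGrading (hyperplaneSection I (d - D))) (t : ℤ)

variable {d r : ℕ}

theorem sectionHilbert_zero (hI : I.IsHomogeneous (homogeneousSubmodule (Fin n) R₀))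
    (hdim : ringKrullDim (MvPolynomial (Fin n) R₀ ⧸ I) = d)
    (hr : ∀ k ≤ d, DegreeBound (hyperplaneSection I k) r) (t : ℕ) (ht : r < t) :
    sectionHilbert I d 0 t = 0 := by
  rw [sectionHilbert, Nat.sub_zero, hilbertFunction]
  have : Subsingleton (quotientGrading (hyperplaneSection I d) (t : ℤ)) := by
    refine subsingleton_of_forall_eq 0 ?_
    rintro ⟨m, hm⟩
    obtain ⟨f, hf, rfl⟩ := exists_of_mem_quotientGrading hm
    refine Subtype.ext (Ideal.Quotient.eq_zero_iff_mem.2 ?_)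
    refine hr d le_rfl t f hf (by exact_mod_cast ht) fun j => ?_
    obtain ⟨l, hl⟩ := X_pow_mem_hyperplaneSection hI hdim j
    exact ⟨l, Ideal.mul_mem_right _ _ hl⟩
  rw [Module.length_eq_zero, ENat.toNat_zero]

theorem exists_sectionHilbert_eq (hI : I.IsHomogeneous (homogeneousSubmodule (Fin n) R₀))
    (hr : ∀ k ≤ d, DegreeBound (hyperplaneSection I k) r) {D : ℕ} (hD : D < d) (t : ℕ) :
    ∃ u, sectionHilbert I d (D + 1) (t + 1) = u + sectionHilbert I d D (t + 1) ∧
      u ≤ sectionHilbert I d (D + 1) t ∧ (r < t → u = sectionHilbert I d (D + 1) t) := by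
  obtain ⟨u, h1, h2, h3⟩ := hilbertFunction_sup_span
    (isHomogeneous_hyperplaneSection hI (d - (D + 1)))
    (isHomogeneous_nextForm (hyperplaneSection I (d - (D + 1)))) t
  refine ⟨u, ?_, h2, fun ht => h3 fun f hf hxf => ?_⟩
  · rw [sectionHilbert, sectionHilbert, h1, show d - D = d - (D + 1) + 1 by omega]
    rfl
  · exact hr _ (Nat.sub_le _ _) t f hf (by exact_mod_cast ht) (isFilterRegular_nextForm _ f hxf)

theorem sectionHilbert_succ (hI : I.IsHomogeneous (homogeneousSubmodule (Fin n) R₀))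
    (hr : ∀ k ≤ d, DegreeBound (hyperplaneSection I k) r) (D : ℕ) (hD : D < d) (t : ℕ)
    (ht : r < t) : sectionHilbert I d (D + 1) (t + 1) =
      sectionHilbert I d (D + 1) t + sectionHilbert I d D (t + 1) := by
  obtain ⟨u, h1, -, h2⟩ := exists_sectionHilbert_eq hI hr hD t
  rw [h1, h2 ht]

theorem sectionHilbert_le (hI : I.IsHomogeneous (homogeneousSubmodule (Fin n) R₀))
    (hdim : ringKrullDim (MvPolynomial (Fin n) R₀ ⧸ I) = d) {c : ℕ} (hc : c + d = n) (D : ℕ)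
    (hD : D < d) (t : ℕ) :
    sectionHilbert I d (D + 1) t ≤ ringLength R₀ * (c + D + t).choose t := by
  have := hilbertFunction_le (isGeneratedBy_hyperplaneSection hI hdim
    (k := d - (D + 1)) (m := c + D + 1) (Nat.sub_le _ _) (by omega)) t
  rwa [show c + D + 1 + t - 1 = c + D + t by omega] at this

theorem isHilbertCoeff_iff {e : Fin d → ℤ} : IsHilbertCoeff (quotientGrading I) d e ↔
    ∀ᶠ t : ℕ in atTop, (sectionHilbert I d d t : ℤ) =
      coeffPoly (fun i => if h : i < d then e ⟨i, h⟩ else 0) d t := by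
  rw [IsHilbertCoeff]
  refine eventually_congr (Eventually.of_forall fun t => ?_)
  rw [sectionHilbert, Nat.sub_self, coeffPoly,
    ← Fin.sum_univ_eq_sum_range (fun i => (-1) ^ i * (if h : i < d then e ⟨i, h⟩ else 0) *
      binomPoly (d - 1 - i) t)]
  simp only [Fin.is_lt, dif_pos, Fin.eta, binomPoly_natCast]
  rfl

/-- Only some degree bound is needed here, and noetherianity provides it; finiteness of the
regularity plays no role. -/
theorem exists_isHilbertCoeff (hI : I.IsHomogeneous (homogeneousSubmodule (Fin n) R₀))
    (hdim : ringKrullDim (MvPolynomial (Fin n) R₀ ⧸ I) = d) :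
    ∃ e : Fin d → ℤ, IsHilbertCoeff (quotientGrading I) d e := by
  obtain ⟨r, hr⟩ := exists_degreeBound_hyperplaneSection hI d
  obtain ⟨e, he⟩ := exists_coeff (g := fun D t => (sectionHilbert I d D t : ℤ)) (d := d) (r := r)
    (fun t ht => by exact_mod_cast sectionHilbert_zero hI hdim hr t ht)
    (fun D hD t ht => by exact_mod_cast sectionHilbert_succ hI hr D hD t ht)
  refine ⟨fun i => e i, isHilbertCoeff_iff.2 (eventually_atTop.2 ⟨r + 1, fun t ht => ?_⟩)⟩
  rw [he t ht]
  exact coeffPoly_congr (fun i hi => by rw [dif_pos hi]) t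

theorem hilbertCoeff_bounds (hI : I.IsHomogeneous (homogeneousSubmodule (Fin n) R₀))
    (hdim : ringKrullDim (MvPolynomial (Fin n) R₀ ⧸ I) = d) {c : ℕ} (hc : c + d = n)
    (h : VanishesAbove I d r) {e : Fin d → ℤ} (he : IsHilbertCoeff (quotientGrading I) d e) :
    (∀ hd : 0 < d, 0 ≤ e ⟨0, hd⟩ ∧ e ⟨0, hd⟩ ≤ ringLength R₀ * (c + r).choose r) ∧
      ∀ i : Fin d, 1 ≤ (i : ℕ) → |e i| ≤ ringLength R₀ * (r + 1) ^ (c + i) := by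
  have hr : ∀ k ≤ d, DegreeBound (hyperplaneSection I k) r := fun k hk => h.degreeBound hI hk
  obtain ⟨h1, h2⟩ := coeff_bounds (g := sectionHilbert I d) (c := c) (l := ringLength R₀)
    (sectionHilbert_zero hI hdim hr) (sectionHilbert_succ hI hr)
    (fun D hD => by
      obtain ⟨u, hu, hu', -⟩ := exists_sectionHilbert_eq hI hr hD r
      exact ⟨u, hu, hu'⟩)
    (fun D hD => sectionHilbert_le hI hdim hc D hD r) (isHilbertCoeff_iff.1 he)
  refine ⟨fun hd => by simpa [hd] using h1 hd, fun i hi => by simpa using h2 i hi i.2⟩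

end HyperplaneSections

/-! ### From vanishing bounds to the regularity -/

section Regularity

variable {n : ℕ} {R₀ : Type*} [CommRing R₀] {I : Ideal (MvPolynomial (Fin n) R₀)} {d : ℕ}

/-- A real value of the regularity may be replaced by its floor, since `t + i` is an integer; the
value `-∞` would give vanishing above `-1`, contradicting `hnonneg`; the value `+∞` needs no
argument. -/
theorem le_reg (hdim : ringKrullDim (MvPolynomial (Fin n) R₀ ⧸ I) = d)
    (hnonneg : ∀ r : ℤ, VanishesAbove I d r → 0 ≤ r) {L : ℝ}
    (hL : ∀ r : ℕ, VanishesAbove I d r → L ≤ r) :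
    (L : EReal) ≤ reg n R₀ (quotientGrading I) := by
  have key : ∀ i ≤ d, ∀ t : ℤ, localCohomologyDeg n R₀ (quotientGrading I) i t ≠ ⊥ →
      (((t + i : ℤ) : ℝ) : EReal) ≤ reg n R₀ (quotientGrading I) := by
    intro i hi t ht
    have h1 : ((t : ℝ) : EReal) ≤ aInv n R₀ (quotientGrading I) i :=
      le_iSup₂ (f := fun (t : ℤ) (_ : localCohomologyDeg n R₀ (quotientGrading I) i t ≠ ⊥) =>
        ((t : ℝ) : EReal)) t ht
    have h2 : (i : WithBot ℕ∞) ≤ Module.supportDim (MvPolynomial (Fin n) R₀)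
        (MvPolynomial (Fin n) R₀ ⧸ I) := by
      rw [Module.supportDim_quotient_eq_ringKrullDim, hdim]
      exact_mod_cast hi
    refine le_trans ?_ (le_iSup₂ (f := fun (i : ℕ) (_ : (i : WithBot ℕ∞) ≤
      Module.supportDim (MvPolynomial (Fin n) R₀) (MvPolynomial (Fin n) R₀ ⧸ I)) =>
        aInv n R₀ (quotientGrading I) i + ((i : ℝ) : EReal)) i h2)
    refine le_trans (le_of_eq ?_) (add_le_add_left h1 _)
    push_cast
    exact EReal.coe_add _ _
  generalize reg n R₀ (quotientGrading I) = ρ at key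
  induction ρ using EReal.rec with
  | bot =>
    have hv : VanishesAbove I d (-1) := fun i hi t _ => by
      by_contra hne
      exact EReal.coe_ne_bot _ (le_bot_iff.1 (key i hi t hne))
    exact absurd (hnonneg _ hv) (by norm_num)
  | coe ρ =>
    have hv : VanishesAbove I d ⌊ρ⌋ := fun i hi t ht => by
      by_contra hne
      have := Int.le_floor.2 (EReal.coe_le_coe_iff.1 (key i hi t hne))
      omega
    obtain ⟨r, hr⟩ := Int.eq_ofNat_of_zero_le (hnonneg _ hv)
    rw [hr] at hv
    refine EReal.coe_le_coe_iff.2 ((hL r hv).trans ?_)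
    have := Int.floor_le ρ
    rw [hr] at this
    exact_mod_cast this
  | top => exact le_top

end Regularity

/-! ### The arithmetic-geometric mean estimate -/

section Real

theorem rpow_inv_factorial_mul_choose_le {c : ℕ} (hc : 1 ≤ c) (r : ℕ) :
    ((c.factorial * (c + r).choose r : ℕ) : ℝ) ^ (1 / (c : ℝ)) ≤ r + ((c : ℝ) + 1) / 2 := by
  have hc' : (0 : ℝ) < c := by exact_mod_cast hc
  -- The factors `r + 1, …, r + c` have arithmetic mean `r + (c + 1) / 2`.
  have h1 : ((c.factorial * (c + r).choose r : ℕ) : ℝ) =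
      ∏ j ∈ Finset.range c, ((r : ℝ) + 1 + j) := by
    rw [← Nat.choose_symm_add, add_comm c r, ← Nat.ascFactorial_eq_factorial_mul_choose,
      Nat.ascFactorial_eq_prod_range]
    push_cast
    rfl
  have h2 := Real.geom_mean_le_arith_mean (Finset.range c) (fun _ => 1)
    (fun j => (r : ℝ) + 1 + j) (fun _ _ => zero_le_one) (by simpa using hc')
    (fun _ _ => by positivity)
  simp only [Real.rpow_one, Finset.sum_const, Finset.card_range, nsmul_eq_mul, mul_one,
    one_mul] at h2
  rw [h1, one_div]
  refine h2.trans (le_of_eq ?_)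
  have h3 : ∑ j ∈ Finset.range c, ((r : ℝ) + 1 + j) = c * (r + 1) + c * (c - 1) / 2 := by
    clear h1 h2 hc hc'
    induction c with
    | zero => simp
    | succ c ih => rw [Finset.sum_range_succ, ih]; push_cast; ring
  rw [h3]
  field_simp
  ring

end Real

end CMReg

end

/-! ### The two lower bounds for the regularity -/

theorem propositionD {R₀ : Type*} [CommRing R₀] [IsArtinianRing R₀] [IsLocalRing R₀]
    [Infinite (IsLocalRing.ResidueField R₀)] (n d c : ℕ)
    (I : Ideal (MvPolynomial (Fin n) R₀))
    (hI : I.IsHomogeneous (MvPolynomial.homogeneousSubmodule (Fin n) R₀))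
    (hIR : I ≤ (HomogeneousIdeal.irrelevant
      (MvPolynomial.homogeneousSubmodule (Fin n) R₀)).toIdeal)
    (hdim : ringKrullDim (MvPolynomial (Fin n) R₀ ⧸ I) = (d : WithBot ℕ∞))
    (hd : 1 ≤ d) (hc : (c : ℤ) = (n : ℤ) - (d : ℤ)) :
    CMReg.IsHilbertCoeff (CMReg.quotientGrading I) d
        (CMReg.hilbertCoeff (CMReg.quotientGrading I) d) ∧
      (1 ≤ c →
        (((((c.factorial : ℝ) * (CMReg.hilbertCoeff (CMReg.quotientGrading I) d ⟨0, hd⟩ : ℝ)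
            / (CMReg.ringLength R₀ : ℝ)) ^ (1 / (c : ℝ)) - ((c : ℝ) + 1) / 2 : ℝ)) : EReal)
          ≤ CMReg.reg n R₀ (CMReg.quotientGrading I)) ∧
      ∀ i : Fin d, 1 ≤ (i : ℕ) →
        ((((|(CMReg.hilbertCoeff (CMReg.quotientGrading I) d i : ℝ)|
            / (CMReg.ringLength R₀ : ℝ)) ^ (1 / ((c : ℝ) + ((i : ℕ) : ℝ))) - 1 : ℝ)) : EReal)
          ≤ CMReg.reg n R₀ (CMReg.quotientGrading I) := by
  have hcd : c + d = n := by omega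
  have hIR' : I ≤ RingHom.ker (MvPolynomial.constantCoeff (R := R₀) (σ := Fin n)) := by
    intro f hf
    have h := (HomogeneousIdeal.mem_irrelevant_iff _ _).1 (hIR hf)
    have h' : MvPolynomial.homogeneousComponent 0 f = 0 := by
      rw [← CMReg.coe_decompose_eq_homogeneousComponent]; exact h
    rwa [MvPolynomial.homogeneousComponent_zero, MvPolynomial.C_eq_zero] at h'
  have he : CMReg.IsHilbertCoeff (CMReg.quotientGrading I) d
      (CMReg.hilbertCoeff (CMReg.quotientGrading I) d) :=
    Classical.epsilon_spec (CMReg.exists_isHilbertCoeff hI hdim)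
  have hl : (0 : ℝ) < CMReg.ringLength R₀ := by
    have h1 : Module.length R₀ R₀ ≠ ⊤ := Module.length_ne_top
    have h2 : 0 < Module.length R₀ R₀ := Module.length_pos
    rw [CMReg.ringLength]
    exact_mod_cast Nat.pos_of_ne_zero fun h => (ENat.toNat_eq_zero.1 h).elim h2.ne' h1
  have hnonneg : ∀ r : ℤ, CMReg.VanishesAbove I d r → 0 ≤ r :=
    fun r hr => hr.nonneg hI hIR' hdim
  refine ⟨he, fun hc1 => CMReg.le_reg hdim hnonneg fun r hr => ?_,
    fun i hi => CMReg.le_reg hdim hnonneg fun r hr => ?_⟩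
  · obtain ⟨h0, h1⟩ := (CMReg.hilbertCoeff_bounds hI hdim hcd hr he).1 hd
    have h0' : (0 : ℝ) ≤ CMReg.hilbertCoeff (CMReg.quotientGrading I) d ⟨0, hd⟩ := by
      exact_mod_cast h0
    have h1' : (CMReg.hilbertCoeff (CMReg.quotientGrading I) d ⟨0, hd⟩ : ℝ) ≤
        CMReg.ringLength R₀ * (c + r).choose r := by exact_mod_cast h1
    rw [sub_le_iff_le_add]
    refine le_trans (Real.rpow_le_rpow (by positivity) ?_ (by positivity))
      (CMReg.rpow_inv_factorial_mul_choose_le hc1 r)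
    rw [div_le_iff₀ hl]
    push_cast
    calc (c.factorial : ℝ) * CMReg.hilbertCoeff (CMReg.quotientGrading I) d ⟨0, hd⟩
        ≤ c.factorial * (CMReg.ringLength R₀ * (c + r).choose r) := by gcongr
      _ = _ := by ring
  · have h1 := (CMReg.hilbertCoeff_bounds hI hdim hcd hr he).2 i hi
    have h1' : |(CMReg.hilbertCoeff (CMReg.quotientGrading I) d i : ℝ)| ≤
        CMReg.ringLength R₀ * ((r : ℝ) + 1) ^ (c + (i : ℕ)) := by exact_mod_cast h1
    rw [sub_le_iff_le_add]
    refine le_trans (Real.rpow_le_rpow (z := 1 / ((c : ℝ) + ((i : ℕ) : ℝ)))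
      (y := ((r : ℝ) + 1) ^ (c + (i : ℕ))) (by positivity) ?_ (by positivity)) (le_of_eq ?_)
    · rw [div_le_iff₀ hl, mul_comm]
      exact h1'
    · rw [one_div, ← Nat.cast_add]
      exact Real.pow_rpow_inv_natCast (by positivity) (by omega)
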